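/- Let $d\ge 2$ and let $U:\mathbb R^d\to\mathbb R$ be a $C^1$ function with a unique critical point $x^*$, three times continuously differentiable on $\mathbb R^d\setminus\{x^*\}$, with $\nabla^2U(x)$ positive definite for every $x\ne x^*$, and with $U(x)\to\infty$ as $|x|\to\infty$. For $\varepsilon>0$ and $\rho>0$ let $(X^\varepsilon,V^\varepsilon)$ be the Bouncy Particle Sampler for the potential $\varepsilon^{-1}U$ with refreshment rate $\rho$, started from $X^\varepsilon(0)=x$ and $V^\varepsilon(0)\sim\mathcal N(0,I_d)$: between events $\dot X^\varepsilon=V^\varepsilon$ and $V^\varepsilon$ is constant; bounces occur with intensity $\varepsilon^{-1}\bigl(V^{\varepsilon\top}\nabla U(X^\varepsilon)\bigr)_+$ and replace $V^\varepsilon$ by $V^\varepsilon-2\,n(X^\varepsilon)\,n(X^\varepsilon)^\top V^\varepsilon$, where $n=\nabla U/|\nabla U|$; and the first refreshment of the velocity takes place at an independent exponential time $T_1$ of mean $\rho^{-1}$. For $\gamma>0$ put $B_\gamma=\{y: U(x^*)+\gamma\le U(y)\le U(x^*)+\gamma^{-1}\}$, let $\tau^\varepsilon=\inf\{t\ge0: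 X^\varepsilon(t)\notin B_\gamma\}$, and let $N^\varepsilon_{T_1}$ be the number of bounces in $[0,T_1\wedge\tau^\varepsilon]$ (the refreshment at $T_1$ is not counted). Let $\gamma\in(0,1/2)$ and let $\rho=\rho(\varepsilon)>0$ be either constant, or such that $\rho\to\infty$ and $\varepsilon^{1/2}\rho\to0$ as $\varepsilon\to0$. Then $$\bigl(1+\varepsilon^{-1/2}\rho^{-2}\bigr)^{-1}\,\mathbb E\bigl[N^\varepsilon_{T_1}\bigr]$$ is bounded above and below by positive constants as $\varepsilon\to0$, uniformly over starting points $x$ with $U(x^*)+2\gamma<U(x)<U(x^*)+(2\gamma)^{-1}$: there are constants $0<c\le C<\infty$ such that, for all sufficiently small $\varepsilon>0$ and all such $x$, $$c\,\bigl(1+\varepsilon^{-1/2}\rho^{-2}\bigr)\le\mathbb E\bigl[N^\varepsilon_{T_1}\bigr]\le C\,\bigl(1+\varepsilon^{-1/2}\rho^{-2}\bigr).$$ In particular, if $\rho$ is constant, there are constants $0<c'\le C'<\infty$ such that $c'\varepsilon^{-1/2}\le\mathbb E[N^\varepsilon_{T_1}]\le C'\varepsilon^{-1/2}$ for all sufficiently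 small $\varepsilon>0$ and all such $x$. -/

import Mathlib

open Filter Topology MeasureTheory ProbabilityTheory

namespace BouncyParticle

noncomputable section

/-- The state space `ℝ^d` with its Euclidean norm. -/
abbrev Space (d : ℕ) : Type := EuclideanSpace ℝ (Fin d)

/-- The assumptions on the potential: `U` is `C¹`, it is `C³` away from `xstar`, the point `xstar` is
the unique critical point, the Hessian is positive definite away from `xstar`, and `U(x) → ∞` as
`|x| → ∞`. -/
structure IsAdmissiblePotential {d : ℕ} (U : Space d → ℝ) (xstar : Space d) : Prop where
  contDiff_one : ContDiff ℝ 1 U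
  contDiffOn_three : ContDiffOn ℝ 3 U {xstar}ᶜ
  gradient_eq_zero_iff : ∀ x, gradient U x = 0 ↔ x = xstar
  hessian_pos : ∀ x, x ≠ xstar → ∀ v, v ≠ 0 → 0 < fderiv ℝ (fderiv ℝ U) x v v
  tendsto_atTop : Tendsto U (cocompact (Space d)) atTop

/-- The unit normal `n(x) = ∇U(x) / |∇U(x)|`. -/
def unitNormal {d : ℕ} (U : Space d → ℝ) (x : Space d) : Space d :=
  ‖gradient U x‖⁻¹ • gradient U x

/-- The velocity after a bounce at `x`: `v - 2 n(x) n(x)ᵀ v`. -/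
def bounce {d : ℕ} (U : Space d → ℝ) (x v : Space d) : Space d :=
  v - (2 * inner ℝ (unitNormal U x) v) • unitNormal U x

/-- The bounce intensity `ε⁻¹ (vᵀ ∇U(x))₊` of the sampler with potential `ε⁻¹ U`. -/
def bounceRate {d : ℕ} (U : Space d → ℝ) (ε : ℝ) (x v : Space d) : ℝ :=
  ε⁻¹ * max (inner ℝ v (gradient U x)) 0

/-- The bounce intensity integrated along the free flight `s ↦ x + s v`, `0 ≤ s ≤ t`. -/
def cumulativeRate {d : ℕ} (U : Space d → ℝ) (ε : ℝ) (x v : Space d) (t : ℝ) : ℝ :=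
  ∫ s in (0 : ℝ)..t, bounceRate U ε (x + s • v) v

/-- The length of the free flight from `(x, v)` until the next bounce: the first time at which the
cumulative intensity reaches the threshold `e` (infinite if this never happens). If `e` is a
standard exponential variable, then this time exceeds `t` with probability
`exp (-cumulativeRate U ε x v t)`. -/
def flightTime {d : ℕ} (U : Space d → ℝ) (ε : ℝ) (x v : Space d) (e : ℝ) : ENNReal :=
  ⨅ (t : NNReal) (_ : e ≤ cumulativeRate U ε x v t), (t : ENNReal)

/-- The bounce skeleton started from `(x, v)` and driven by the thresholds `e`: entry `k` holds the
time of the `k`-th bounce (time `0` for `k = 0`), the position at that time and the velocity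
immediately after it. -/
def skeleton {d : ℕ} (U : Space d → ℝ) (ε : ℝ) (x v : Space d) (e : ℕ → ℝ) :
    ℕ → ENNReal × Space d × Space d
  | 0 => (0, x, v)
  | k + 1 =>
    let z := skeleton U ε x v e k
    let h := flightTime U ε z.2.1 z.2.2 (e k)
    let y := z.2.1 + h.toReal • z.2.2
    (z.1 + h, y, bounce U y z.2.2)

/-- The time of the `k`-th bounce (time `0` for `k = 0`). -/
def bounceTime {d : ℕ} (U : Space d → ℝ) (ε : ℝ) (x v : Space d) (e : ℕ → ℝ) (k : ℕ) : ENNReal :=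
  (skeleton U ε x v e k).1

/-- The number of bounces up to and including time `t`: the first `k` such that bounce `k + 1`
happens after time `t`. -/
def legIndex {d : ℕ} (U : Space d → ℝ) (ε : ℝ) (x v : Space d) (e : ℕ → ℝ) (t : NNReal) : ℕ :=
  sInf {k : ℕ | (t : ENNReal) < bounceTime U ε x v e (k + 1)}

/-- The position `X^ε(t)` (before the first refreshment). -/
def position {d : ℕ} (U : Space d → ℝ) (ε : ℝ) (x v : Space d) (e : ℕ → ℝ) (t : NNReal) :
    Space d :=
  let z := skeleton U ε x v e (legIndex U ε x v e t)
  z.2.1 + ((t : ℝ) - z.1.toReal) • z.2.2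

/-- The energy band `B_γ = {U(x*) + γ ≤ U ≤ U(x*) + γ⁻¹}`. -/
def band {d : ℕ} (U : Space d → ℝ) (xstar : Space d) (γ : ℝ) : Set (Space d) :=
  {x | U xstar + γ ≤ U x ∧ U x ≤ U xstar + γ⁻¹}

/-- The first exit time `τ^ε = inf {t ≥ 0 : X^ε(t) ∉ B_γ}`. -/
def exitTime {d : ℕ} (U : Space d → ℝ) (xstar : Space d) (γ ε : ℝ) (x v : Space d) (e : ℕ → ℝ) :
    ENNReal :=
  ⨅ (t : NNReal) (_ : position U ε x v e t ∉ band U xstar γ), (t : ENNReal)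

/-- The number of bounces in `[0, t ∧ τ^ε]`. -/
def bounceCount {d : ℕ} (U : Space d → ℝ) (xstar : Space d) (γ ε : ℝ) (x v : Space d) (e : ℕ → ℝ)
    (t : ENNReal) : ENat :=
  {k : ℕ | bounceTime U ε x v e (k + 1) ≤ min t (exitTime U xstar γ ε x v e)}.encard

/-- The joint law of the randomness up to the first refreshment: the initial velocity
`W₀ ~ N(0, I_d)`, the first refreshment time `T₁ ~ Exp(ρ)`, and the thresholds, which are
i.i.d. `Exp(1)`; all of these are independent. -/
def driveLaw (d : ℕ) (ρ : ℝ) : Measure (Space d × ℝ × (ℕ → ℝ)) :=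
  (stdGaussian (Space d)).prod
    ((expMeasure ρ).prod (Measure.infinitePi (fun _ : ℕ => expMeasure 1)))

/-- `E[N^ε_{T₁}]`: the expected number of bounces before the first refreshment and before the exit
from `B_γ`, for the Bouncy Particle Sampler with potential `ε⁻¹ U` and refreshment rate `ρ` started
at `x` with a velocity drawn from `N(0, I_d)`. (On `[0, T₁)` the sampler follows the bounce process
above.) -/
def expectedBounces {d : ℕ} (U : Space d → ℝ) (xstar : Space d) (γ ε ρ : ℝ) (x : Space d) :
    ENNReal :=
  ∫⁻ ω, (bounceCount U xstar γ ε x ω.1 ω.2.2 (ENNReal.ofReal ω.2.1) : ENNReal) ∂(driveLaw d ρ)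

end

end BouncyParticle

/-! Along a free flight the slope `vᵀ∇U` increases, at a rate between `m‖v‖²` and `M‖v‖²`, because
the Hessian is bounded above and below on the band. A bounce keeps `‖v‖` and changes the sign of the
slope. A flight that starts with slope `-s ≤ 0` therefore first spends a time of order `s` reaching
slope zero. It then needs an extra time of order `√(ε e)` for the intensity `ε⁻¹ (slope)₊` to
accumulate the threshold `e`, and it ends with slope of order `√(ε e)`. Once the initial slope has
been used up, successive bounces are a time of order `√ε` apart, and a time `t` contains about `t /
√ε` of them.

An initial slope much larger than `t` cannot be used up within time `t`, and then there is at most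
one bounce. The time available is of order `1/ρ`, and under the Gaussian law the slope is `O(1/ρ)`
with probability of order `1/ρ`. The mean number of bounces is thus `1/ρ · 1/(ρ√ε) = ε^(-1/2)
ρ^(-2)`, plus an `O(1)` contribution of the first bounce.

Upper bound: by `bounds_of_bounceTime_le`, having `k + 2` bounces forces a small slope and a small
sum of the `√e`. The renewal estimate `tsum_thresholdLaw_sum_sqrt_le`, the slab estimate
`exists_lintegral_norm_slab_le` and the second moment of the refreshment time then give
`exists_expectedBounces_le`.

Lower bound: `bounceTime_le_of_slope_nonpos` bounds bounce times from above while the path stays in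
a ball inside the band. Evaluating on product events yields `exists_le_expectedBounces`. Upward
initial velocities supply the constant term, and a thin slab of slightly downward ones supplies the
term `ε^(-1/2) ρ^(-2)`. -/

namespace BouncyParticle

section

/-! ### Integrated positive part of a function with controlled growth. -/

section OneDim

variable {u : ℝ → ℝ} {ε M m : ℝ}

lemma intervalIntegrable_posPart (hu : Continuous u) (a b : ℝ) :
    IntervalIntegrable (fun s => ε⁻¹ * max (u s) 0) volume a b :=
  Continuous.intervalIntegrable (by fun_prop) _ _

lemma integral_posPart_mono (hu : Continuous u) (hε : 0 < ε) {s t : ℝ} (hst : s ≤ t) :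
    ∫ r in (0 : ℝ)..s, ε⁻¹ * max (u r) 0 ≤ ∫ r in (0 : ℝ)..t, ε⁻¹ * max (u r) 0 := by
  rw [← intervalIntegral.integral_add_adjacent_intervals (intervalIntegrable_posPart hu 0 s)
    (intervalIntegrable_posPart hu s t)]
  have : 0 ≤ ∫ r in s..t, ε⁻¹ * max (u r) 0 :=
    intervalIntegral.integral_nonneg hst fun r _ => by positivity
  linarith

/-- If `u` is at least `b ≥ 0` on `[p, q] ⊆ [0, t]`, then the integral of its positive part over `[0, t]`
is at least `b * (q - p)`. -/
lemma mul_sub_le_integral_posPart (hu : Continuous u) (hε : 0 < ε) {p q t b : ℝ} (hp : 0 ≤ p)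
    (hpq : p ≤ q) (hqt : q ≤ t) (hb : ∀ r ∈ Set.Icc p q, b ≤ u r) :
    ε⁻¹ * (b * (q - p)) ≤ ∫ r in (0 : ℝ)..t, ε⁻¹ * max (u r) 0 := by
  refine le_trans ?_ (integral_posPart_mono hu hε hqt)
  rw [← intervalIntegral.integral_add_adjacent_intervals (intervalIntegrable_posPart hu 0 p)
    (intervalIntegrable_posPart hu p q)]
  have h1 : 0 ≤ ∫ r in (0 : ℝ)..p, ε⁻¹ * max (u r) 0 :=
    intervalIntegral.integral_nonneg hp fun r _ => by positivity
  have h2 : ∫ _ in p..q, ε⁻¹ * b ≤ ∫ r in p..q, ε⁻¹ * max (u r) 0 := by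
    refine intervalIntegral.integral_mono_on hpq (by simp) (intervalIntegrable_posPart hu p q) ?_
    intro r hr
    have := hb r hr
    gcongr
    exact this.trans (le_max_left _ _)
  rw [intervalIntegral.integral_const, smul_eq_mul] at h2
  nlinarith

/-- If `u 0 ≤ 0` and `u` grows at rate at most `M`, the integrated positive part is at most
`M t²`. -/
lemma integral_posPart_le (hu : Continuous u) (hε : 0 < ε) {t : ℝ} (ht : 0 ≤ t) (hM : 0 ≤ M)
    (h0 : u 0 ≤ 0) (h : ∀ r ∈ Set.Icc 0 t, u r - u 0 ≤ M * r) :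
    ∫ r in (0 : ℝ)..t, ε⁻¹ * max (u r) 0 ≤ ε⁻¹ * (M * t ^ 2) := by
  have h2 : ∫ r in (0 : ℝ)..t, ε⁻¹ * max (u r) 0 ≤ ∫ _ in (0 : ℝ)..t, ε⁻¹ * (M * t) := by
    refine intervalIntegral.integral_mono_on ht (intervalIntegrable_posPart hu 0 t) (by simp) ?_
    intro r hr
    have h1 := h r hr
    have h3 : M * r ≤ M * t := mul_le_mul_of_nonneg_left hr.2 hM
    have h4 : 0 ≤ M * t := mul_nonneg hM ht
    gcongr
    exact max_le (by linarith) h4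
  rw [intervalIntegral.integral_const, smul_eq_mul] at h2
  nlinarith

lemma integral_posPart_eq_zero {t : ℝ} (ht : 0 ≤ t) (h : ∀ r ∈ Set.Icc 0 t, u r ≤ 0) :
    ∫ r in (0 : ℝ)..t, ε⁻¹ * max (u r) 0 = 0 := by
  rw [intervalIntegral.integral_congr (g := fun _ => 0), intervalIntegral.integral_zero]
  intro r hr
  rw [Set.uIcc_of_le ht] at hr
  simp [max_eq_right (h r hr)]

/-- If `u` grows at rate at least `m`, the integrated positive part reaches `e` within the time
needed for `u` to become nonnegative and twice `√(ε e / m)`. -/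
lemma le_integral_posPart (hu : Continuous u) (hε : 0 < ε) (hm : 0 < m) {e t : ℝ} (he : 0 ≤ e)
    (ht : t = max (-u 0) 0 / m + 2 * √(ε * e / m))
    (h : ∀ r ∈ Set.Icc 0 t, m * r ≤ u r - u 0) :
    e ≤ ∫ r in (0 : ℝ)..t, ε⁻¹ * max (u r) 0 := by
  set w := √(ε * e / m)
  set a := max (-u 0) 0 / m
  have hw : 0 ≤ w := Real.sqrt_nonneg _
  have ha : 0 ≤ a := by positivity
  have ha' : -u 0 ≤ m * a := by
    simp only [a]; rw [mul_div_cancel₀ _ hm.ne']; exact le_max_left _ _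
  have hw2 : w ^ 2 = ε * e / m := Real.sq_sqrt (by positivity)
  -- By time `a` the function is nonnegative, so it is at least `m w` on `[a + w, a + 2w]`. This
  -- interval alone contributes `ε⁻¹ m w² = e`.
  have key := mul_sub_le_integral_posPart (u := u) (p := a + w) (q := t) (t := t) (b := m * w) hu hε
    (by positivity) (by linarith) le_rfl (by
      intro r hr
      have := h r ⟨by linarith [hr.1], hr.2⟩
      nlinarith [hr.1])
  refine le_trans (le_of_eq ?_) key
  have : m * w * (t - (a + w)) = m * w ^ 2 := by rw [ht]; ring
  rw [this, hw2]
  field_simp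

/-- If `u 0 ≤ 0` and `u` grows at rate at most `M`, then a final value above `2 √(M ε e)` forces the
integrated positive part to exceed `e`. -/
lemma le_of_integral_posPart_le (hu : Continuous u) (hε : 0 < ε) (hM : 0 < M) {e t : ℝ} (ht : 0 ≤ t)
    (h0 : u 0 ≤ 0) (h : ∀ r ∈ Set.Icc 0 t, u t - u r ≤ M * (t - r))
    (hint : ∫ r in (0 : ℝ)..t, ε⁻¹ * max (u r) 0 ≤ e) :
    u t ≤ 2 * √(M * (ε * e)) := by
  rcases le_total (u t) 0 with hneg | hpos
  · exact hneg.trans (by positivity)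
  have hut : u t ≤ M * t := by have := h 0 ⟨le_rfl, ht⟩; linarith
  have hp : 0 ≤ t - u t / (2 * M) := by
    have : u t / (2 * M) ≤ t := by rw [div_le_iff₀ (by positivity)]; nlinarith
    linarith
  have hq : 0 ≤ u t / (2 * M) := by positivity
  -- Looking back from `t`, the function stays above `u t / 2` for a time `u t / (2M)`. This
  -- contributes `ε⁻¹ (u t)² / (4M)`, which is at most `e`.
  have key := mul_sub_le_integral_posPart (u := u) (p := t - u t / (2 * M)) (q := t) (t := t)
    (b := u t / 2) hu hε hp (by linarith) le_rfl (by
      intro r hr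
      have h1 := h r ⟨by linarith [hr.1], hr.2⟩
      have h2 : M * (t - r) ≤ M * (u t / (2 * M)) :=
        mul_le_mul_of_nonneg_left (by linarith [hr.1]) hM.le
      have h3 : M * (u t / (2 * M)) = u t / 2 := by field_simp
      linarith)
  have h4 := key.trans hint
  have h5 : u t / 2 * (t - (t - u t / (2 * M))) = u t ^ 2 / (4 * M) := by field_simp; ring
  rw [h5, inv_mul_le_iff₀ hε, div_le_iff₀ (by positivity)] at h4
  have h6 : u t / 2 ≤ √(M * (ε * e)) := by
    apply Real.le_sqrt_of_sq_le
    nlinarith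
  linarith

end OneDim

/-! ### Slope, reflection and flight time. -/

variable {d : ℕ} {U : Space d → ℝ} {xstar : Space d}

/-- The directional derivative `vᵀ ∇U(x)`. -/
noncomputable def slope (U : Space d → ℝ) (x v : Space d) : ℝ := inner ℝ v (gradient U x)

lemma slope_eq_fderiv (x v : Space d) : slope U x v = fderiv ℝ U x v := by
  rw [slope, gradient, real_inner_comm, InnerProductSpace.toDual_symm_apply]

lemma continuous_gradient (hU : ContDiff ℝ 1 U) : Continuous (gradient U) :=
  (InnerProductSpace.toDual ℝ (Space d)).symm.continuous.comp (hU.continuous_fderiv (by norm_num))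

lemma continuous_slope_line (hU : ContDiff ℝ 1 U) (x v : Space d) :
    Continuous fun s : ℝ => slope U (x + s • v) v := by
  have := continuous_gradient hU
  unfold slope
  fun_prop

lemma cumulativeRate_eq (ε : ℝ) (x v : Space d) (t : ℝ) :
    cumulativeRate U ε x v t = ∫ s in (0 : ℝ)..t, ε⁻¹ * max (slope U (x + s • v) v) 0 := rfl

lemma norm_unitNormal {x : Space d} (h : gradient U x ≠ 0) : ‖unitNormal U x‖ = 1 := by
  rw [unitNormal, norm_smul, norm_inv, norm_norm, inv_mul_cancel₀ (norm_ne_zero_iff.2 h)]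

lemma norm_bounce (y v : Space d) : ‖bounce U y v‖ = ‖v‖ := by
  have key : ‖bounce U y v‖ ^ 2 = ‖v‖ ^ 2 := by
    rw [bounce, norm_sub_sq_real, norm_smul, inner_smul_right, real_inner_comm v]
    by_cases h : gradient U y = 0
    · simp [unitNormal, h]
    · rw [norm_unitNormal h, Real.norm_eq_abs, mul_one, sq_abs]
      ring
  exact (sq_eq_sq₀ (norm_nonneg _) (norm_nonneg _)).1 key

/-- The reflection reverses the component along the gradient. At a critical point both sides vanish.
-/
lemma slope_bounce (y v : Space d) : slope U y (bounce U y v) = -slope U y v := by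
  unfold slope bounce
  by_cases h : gradient U y = 0
  · simp [h]
  · have h0 : ‖gradient U y‖ ≠ 0 := norm_ne_zero_iff.2 h
    rw [inner_sub_left, unitNormal, real_inner_smul_left, real_inner_smul_left,
      real_inner_smul_left, real_inner_self_eq_norm_sq, real_inner_comm]
    field_simp
    ring

lemma slope_eq_norm_mul (x v : Space d) :
    slope U x v = ‖gradient U x‖ * inner ℝ (unitNormal U x) v := by
  unfold slope unitNormal
  by_cases h : gradient U x = 0
  · simp [h]
  · have h0 : ‖gradient U x‖ ≠ 0 := norm_ne_zero_iff.2 h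
    rw [real_inner_smul_left, real_inner_comm]
    field_simp

section Flight

variable {ε : ℝ} {x v : Space d} {e : ℝ}

lemma flightTime_le {t : ℝ} (ht : 0 ≤ t) (h : e ≤ cumulativeRate U ε x v t) :
    flightTime U ε x v e ≤ ENNReal.ofReal t :=
  (iInf₂_le (⟨t, ht⟩ : NNReal) h).trans_eq (ENNReal.ofReal_eq_coe_nnreal ht).symm

lemma cumulativeRate_lt {t : ℝ} (ht : 0 ≤ t) (h : ENNReal.ofReal t < flightTime U ε x v e) :
    cumulativeRate U ε x v t < e := by
  by_contra! h'
  exact absurd (flightTime_le ht h') (not_le.2 h)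

lemma continuous_cumulativeRate (hU : ContDiff ℝ 1 U) : Continuous (cumulativeRate U ε x v) := by
  have h : ∀ a b, IntervalIntegrable (fun s => ε⁻¹ * max (slope U (x + s • v) v) 0) volume a b :=
    intervalIntegrable_posPart (continuous_slope_line hU x v)
  exact intervalIntegral.continuous_primitive h 0

/-- The infimum is attained because the cumulative rate is continuous and nondecreasing. Together
with `cumulativeRate_flightTime_le`, the rate accumulated over a finite flight is exactly `e`. -/
lemma le_cumulativeRate_flightTime (hU : ContDiff ℝ 1 U) (hε : 0 < ε)
    (h : flightTime U ε x v e ≠ ⊤) :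
    e ≤ cumulativeRate U ε x v (flightTime U ε x v e).toReal := by
  set h0 := (flightTime U ε x v e).toReal with hh0
  by_contra! hlt
  have hnn : 0 ≤ h0 := ENNReal.toReal_nonneg
  have hev : ∀ᶠ t in 𝓝[>] h0, cumulativeRate U ε x v t < e :=
    ((continuous_cumulativeRate hU).tendsto h0).eventually_lt_const hlt |>.filter_mono
      nhdsWithin_le_nhds
  obtain ⟨t, ht, htgt⟩ := (hev.and self_mem_nhdsWithin).exists
  have htgt : h0 < t := htgt
  have : ENNReal.ofReal t ≤ flightTime U ε x v e := by
    refine le_iInf₂ fun s hs => ?_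
    by_contra! hst
    rw [ENNReal.lt_ofReal_iff_toReal_lt (by simp)] at hst
    simp only [ENNReal.coe_toReal] at hst
    have := integral_posPart_mono (continuous_slope_line hU x v) hε hst.le
    rw [← cumulativeRate_eq, ← cumulativeRate_eq] at this
    exact absurd (hs.trans this) (not_le.2 ht)
  have h2 := (ENNReal.ofReal_le_iff_le_toReal h).1 this
  linarith

lemma cumulativeRate_flightTime_le (hU : ContDiff ℝ 1 U) (he : 0 ≤ e)
    (h : flightTime U ε x v e ≠ ⊤) :
    cumulativeRate U ε x v (flightTime U ε x v e).toReal ≤ e := by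
  set h0 := (flightTime U ε x v e).toReal with hh0
  have hnn : 0 ≤ h0 := ENNReal.toReal_nonneg
  rcases hnn.eq_or_lt with h1 | h1
  · rw [← h1]; simpa [cumulativeRate] using he
  · have hev : ∀ᶠ t in 𝓝[<] h0, cumulativeRate U ε x v t ≤ e := by
      filter_upwards [Ioo_mem_nhdsLT h1] with t ht
      exact (cumulativeRate_lt ht.1.le ((ENNReal.ofReal_lt_iff_lt_toReal ht.1.le h).2 ht.2)).le
    exact le_of_tendsto (((continuous_cumulativeRate hU).tendsto h0).mono_left nhdsWithin_le_nhds) hev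

lemma flightTime_pos (hU : ContDiff ℝ 1 U) (hε : 0 < ε) (he : 0 < e)
    (h : flightTime U ε x v e ≠ ⊤) : 0 < (flightTime U ε x v e).toReal := by
  rcases (ENNReal.toReal_nonneg (a := flightTime U ε x v e)).eq_or_lt with h1 | h1
  · have := le_cumulativeRate_flightTime hU hε h
    rw [← h1] at this
    simp [cumulativeRate] at this
    linarith
  · exact h1

end Flight

end

/-! ### Derivative bounds on the band and their effect along a segment. -/

section

variable {d : ℕ} {U : Space d → ℝ} {xstar : Space d}

/-- Uniform bounds on the first two derivatives of `U` on the set `B`. -/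
structure DerivBounds (U : Space d → ℝ) (B : Set (Space d)) (m M g G : ℝ) : Prop where
  m_pos : 0 < m
  M_pos : 0 < M
  g_pos : 0 < g
  G_pos : 0 < G
  contDiff : ContDiff ℝ 1 U
  differentiableAt : ∀ x ∈ B, DifferentiableAt ℝ (fderiv ℝ U) x
  lower : ∀ x ∈ B, ∀ v, m * ‖v‖ ^ 2 ≤ fderiv ℝ (fderiv ℝ U) x v v
  upper : ∀ x ∈ B, ∀ v, fderiv ℝ (fderiv ℝ U) x v v ≤ M * ‖v‖ ^ 2
  gradient_lower : ∀ x ∈ B, g ≤ ‖gradient U x‖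
  gradient_upper : ∀ x ∈ B, ‖gradient U x‖ ≤ G

lemma band_isCompact (hU : IsAdmissiblePotential U xstar) (γ : ℝ) :
    IsCompact (band U xstar γ) := by
  have hc := hU.contDiff_one.continuous
  have hclosed : IsClosed (band U xstar γ) :=
    (isClosed_le continuous_const hc).inter (isClosed_le hc continuous_const)
  have h := hU.tendsto_atTop.eventually (eventually_gt_atTop (U xstar + γ⁻¹))
  obtain ⟨K, hK, hKs⟩ := mem_cocompact.1 h
  refine hK.of_isClosed_subset hclosed fun x hx => ?_
  by_contra hxK
  exact absurd hx.2 (not_le.2 (hKs hxK))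

lemma exists_derivBounds (hU : IsAdmissiblePotential U xstar) {γ : ℝ} (hγ : 0 < γ) :
    ∃ m M g G, DerivBounds U (band U xstar γ) m M g G := by
  have hK := band_isCompact hU γ
  have hne : ∀ x ∈ band U xstar γ, x ≠ xstar := by
    rintro x hx rfl
    linarith [hx.1]
  have hopen : IsOpen ({xstar}ᶜ : Set (Space d)) := isOpen_compl_singleton
  have hC2 : ContDiffOn ℝ 2 (fderiv ℝ U) {xstar}ᶜ :=
    hU.contDiffOn_three.fderiv_of_isOpen hopen (by norm_num)
  have hC1 : ContinuousOn (fderiv ℝ (fderiv ℝ U)) {xstar}ᶜ :=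
    hC2.continuousOn_fderiv_of_isOpen hopen (by norm_num)
  set S := band U xstar γ ×ˢ Metric.sphere (0 : Space d) 1
  have hS : IsCompact S := hK.prod (isCompact_sphere _ _)
  have hq : ContinuousOn (fun p : Space d × Space d => fderiv ℝ (fderiv ℝ U) p.1 p.2 p.2) S := by
    have : ContinuousOn (fun p : Space d × Space d => fderiv ℝ (fderiv ℝ U) p.1) S :=
      hC1.comp continuousOn_fst fun p hp => hne _ hp.1
    exact (this.clm_apply continuousOn_snd).clm_apply continuousOn_snd
  have hg := (continuous_gradient hU.contDiff_one).norm
  obtain ⟨m, hm, hm'⟩ : ∃ m : ℝ, 0 < m ∧ ∀ p ∈ S, m ≤ fderiv ℝ (fderiv ℝ U) p.1 p.2 p.2 := by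
    rcases S.eq_empty_or_nonempty with h | h
    -- Nonemptiness of the compact set is not established, so the empty case takes an arbitrary
    -- positive constant.
    · exact ⟨1, one_pos, by simp [h]⟩
    · obtain ⟨p, hp, hmin⟩ := hS.exists_isMinOn h hq
      refine ⟨_, hU.hessian_pos p.1 (hne _ hp.1) p.2 ?_, fun q hq => hmin hq⟩
      rintro h0
      have := hp.2
      simp [h0] at this
  obtain ⟨M, hM⟩ := hS.bddAbove_image hq
  obtain ⟨g, hg0, hg'⟩ : ∃ g : ℝ, 0 < g ∧ ∀ x ∈ band U xstar γ, g ≤ ‖gradient U x‖ := by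
    rcases (band U xstar γ).eq_empty_or_nonempty with h | h
    · exact ⟨1, one_pos, by simp [h]⟩
    · obtain ⟨p, hp, hmin⟩ := hK.exists_isMinOn h hg.continuousOn
      refine ⟨_, norm_pos_iff.2 fun h0 => hne p hp ((hU.gradient_eq_zero_iff p).1 h0), hmin⟩
  obtain ⟨G, hG⟩ := hK.bddAbove_image hg.continuousOn
  have hscale : ∀ x v : Space d, v ≠ 0 → fderiv ℝ (fderiv ℝ U) x v v =
      fderiv ℝ (fderiv ℝ U) x (‖v‖⁻¹ • v) (‖v‖⁻¹ • v) * ‖v‖ ^ 2 := by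
    intro x v hv
    have := norm_ne_zero_iff.2 hv
    simp only [map_smul, _root_.smul_apply, smul_eq_mul]
    field_simp
  have hsph : ∀ v : Space d, v ≠ 0 → ‖v‖⁻¹ • v ∈ Metric.sphere (0 : Space d) 1 := by
    intro v hv
    rw [mem_sphere_zero_iff_norm, norm_smul, norm_inv, norm_norm,
      inv_mul_cancel₀ (norm_ne_zero_iff.2 hv)]
  refine ⟨m, max M 1, g, max G 1, hm, by positivity, hg0, by positivity, hU.contDiff_one, ?_, ?_, ?_,
    hg', fun x hx => (hG ⟨x, hx, rfl⟩).trans (le_max_left _ _)⟩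
  · intro x hx
    exact ((hC2.contDiffAt (hopen.mem_nhds (hne x hx))).differentiableAt (by norm_num))
  · intro x hx v
    by_cases hv : v = 0
    · simp [hv]
    · rw [hscale x v hv]
      exact mul_le_mul_of_nonneg_right (hm' (x, ‖v‖⁻¹ • v) ⟨hx, hsph v hv⟩) (by positivity)
  · intro x hx v
    by_cases hv : v = 0
    · simp [hv]
    · rw [hscale x v hv]
      exact mul_le_mul_of_nonneg_right
        ((hM ⟨(x, ‖v‖⁻¹ • v), ⟨hx, hsph v hv⟩, rfl⟩).trans (le_max_left _ _)) (by positivity)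

/-- The smaller closed band is compact inside an open subset of the larger one, so a single radius
serves all starting points. This is the source of uniformity in `x` for the lower bound. -/
lemma exists_closedBall_subset_band (hU : IsAdmissiblePotential U xstar) {γ : ℝ} (hγ : 0 < γ) :
    ∃ r > 0, ∀ x, U xstar + 2 * γ < U x → U x < U xstar + (2 * γ)⁻¹ →
      Metric.closedBall x r ⊆ band U xstar γ := by
  have hc := hU.contDiff_one.continuous
  set O : Set (Space d) := {x | U xstar + γ < U x ∧ U x < U xstar + γ⁻¹}
  have hO : IsOpen O := (isOpen_lt continuous_const hc).inter (isOpen_lt hc continuous_const)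
  have hsub : band U xstar (2 * γ) ⊆ O := fun x hx =>
    ⟨by linarith [hx.1], hx.2.trans_lt (by
      have : (2 * γ)⁻¹ < γ⁻¹ := inv_strictAnti₀ hγ (by linarith)
      linarith)⟩
  obtain ⟨r, hr, hrs⟩ := (band_isCompact hU (2 * γ)).exists_cthickening_subset_open hO hsub
  refine ⟨r, hr, fun x h1 h2 y hy => ?_⟩
  have hx : x ∈ band U xstar (2 * γ) := ⟨h1.le, h2.le⟩
  have := hrs (Metric.closedBall_subset_cthickening hx r hy)
  exact ⟨this.1.le, this.2.le⟩

section Segment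

variable {B : Set (Space d)} {m M g G : ℝ} {x v : Space d} {T : ℝ}

lemma hasDerivAt_slope (hB : DerivBounds U B m M g G) {t : ℝ} (h : x + t • v ∈ B) :
    HasDerivAt (fun s : ℝ => slope U (x + s • v) v)
      (fderiv ℝ (fderiv ℝ U) (x + t • v) v v) t := by
  simp only [slope_eq_fderiv]
  have h1 : HasDerivAt (fun s : ℝ => x + s • v) v t := by
    simpa using ((hasDerivAt_id t).smul_const v).const_add x
  have h2 := ((hB.differentiableAt _ h).hasFDerivAt).comp_hasDerivAt t h1
  simpa using h2.clm_apply (hasDerivAt_const t v)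

lemma slope_sub_le (hB : DerivBounds U B m M g G) (h : ∀ t ∈ Set.Icc 0 T, x + t • v ∈ B)
    {s t : ℝ} (hs : 0 ≤ s) (hst : s ≤ t) (ht : t ≤ T) :
    slope U (x + t • v) v - slope U (x + s • v) v ≤ M * ‖v‖ ^ 2 * (t - s) := by
  have hd : ∀ r ∈ Set.Icc 0 T, HasDerivAt (fun s : ℝ => slope U (x + s • v) v) _ r :=
    fun r hr => hasDerivAt_slope hB (h r hr)
  refine Convex.image_sub_le_mul_sub_of_deriv_le (convex_Icc 0 T)
    (continuous_slope_line hB.contDiff x v).continuousOn ?_ ?_ s ⟨hs, hst.trans ht⟩ t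
    ⟨hs.trans hst, ht⟩ hst
  · exact fun r hr => (hd r (interior_subset hr)).differentiableAt.differentiableWithinAt
  · intro r hr
    rw [(hd r (interior_subset hr)).deriv]
    exact hB.upper _ (h r (interior_subset hr)) v

lemma le_slope_sub (hB : DerivBounds U B m M g G) (h : ∀ t ∈ Set.Icc 0 T, x + t • v ∈ B)
    {s t : ℝ} (hs : 0 ≤ s) (hst : s ≤ t) (ht : t ≤ T) :
    m * ‖v‖ ^ 2 * (t - s) ≤ slope U (x + t • v) v - slope U (x + s • v) v := by
  have hd : ∀ r ∈ Set.Icc 0 T, HasDerivAt (fun s : ℝ => slope U (x + s • v) v) _ r :=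
    fun r hr => hasDerivAt_slope hB (h r hr)
  refine Convex.mul_sub_le_image_sub_of_le_deriv (convex_Icc 0 T)
    (continuous_slope_line hB.contDiff x v).continuousOn ?_ ?_ s ⟨hs, hst.trans ht⟩ t
    ⟨hs.trans hst, ht⟩ hst
  · exact fun r hr => (hd r (interior_subset hr)).differentiableAt.differentiableWithinAt
  · intro r hr
    rw [(hd r (interior_subset hr)).deriv]
    exact hB.lower _ (h r (interior_subset hr)) v

variable {ε e : ℝ}

/-- The slope is nondecreasing along the segment. A nonpositive final value would make the intensity
vanish throughout, and no positive threshold could be reached. -/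
lemma slope_pos_of_le_cumulativeRate (hB : DerivBounds U B m M g G) (he : 0 < e)
    (hT : 0 ≤ T) (hseg : ∀ t ∈ Set.Icc 0 T, x + t • v ∈ B) (hce : e ≤ cumulativeRate U ε x v T) :
    0 < slope U (x + T • v) v := by
  by_contra! hneg
  have : cumulativeRate U ε x v T = 0 := by
    refine integral_posPart_eq_zero (u := fun s : ℝ => slope U (x + s • v) v) hT fun r hr => ?_
    have := le_slope_sub hB hseg hr.1 hr.2 le_rfl
    have h2 : 0 ≤ m * ‖v‖ ^ 2 * (T - r) :=
      mul_nonneg (mul_nonneg hB.m_pos.le (by positivity)) (by linarith [hr.2])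
    show slope U (x + r • v) v ≤ 0
    linarith
  linarith

lemma mul_le_of_le_cumulativeRate (hB : DerivBounds U B m M g G) (hε : 0 < ε)
    (hT : 0 ≤ T) (hseg : ∀ t ∈ Set.Icc 0 T, x + t • v ∈ B) (h0 : slope U x v ≤ 0)
    (hce : e ≤ cumulativeRate U ε x v T) : ε * e ≤ M * (‖v‖ * T) ^ 2 := by
  have := integral_posPart_le (u := fun s : ℝ => slope U (x + s • v) v) (ε := ε) (t := T)
    (M := M * ‖v‖ ^ 2) (continuous_slope_line hB.contDiff x v) hε hT
    (mul_nonneg hB.M_pos.le (by positivity)) (by simpa using h0) (fun r hr => by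
      simpa using slope_sub_le hB hseg le_rfl hr.1 hr.2)
  have h2 : e ≤ ε⁻¹ * (M * ‖v‖ ^ 2 * T ^ 2) := hce.trans this
  rw [le_inv_mul_iff₀ hε] at h2
  linarith

end Segment

end

/-! ### The bounce skeleton, the position and the exit time. -/

section

variable {d : ℕ} {U : Space d → ℝ} {xstar : Space d}

section Skeleton

variable {ε : ℝ} {x v : Space d} {e : ℕ → ℝ}

lemma bounceTime_succ (k : ℕ) : bounceTime U ε x v e (k + 1) = bounceTime U ε x v e k +
    flightTime U ε (skeleton U ε x v e k).2.1 (skeleton U ε x v e k).2.2 (e k) := rfl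

lemma skeleton_pos_succ (k : ℕ) : (skeleton U ε x v e (k + 1)).2.1 = (skeleton U ε x v e k).2.1 +
    (flightTime U ε (skeleton U ε x v e k).2.1 (skeleton U ε x v e k).2.2 (e k)).toReal •
      (skeleton U ε x v e k).2.2 := rfl

lemma skeleton_vel_succ (k : ℕ) : (skeleton U ε x v e (k + 1)).2.2 =
    bounce U (skeleton U ε x v e (k + 1)).2.1 (skeleton U ε x v e k).2.2 := rfl

lemma norm_skeleton_vel (k : ℕ) : ‖(skeleton U ε x v e k).2.2‖ = ‖v‖ := by
  induction k with
  | zero => rfl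
  | succ k ih => rw [skeleton_vel_succ, norm_bounce, ih]

lemma bounceTime_monotone : Monotone (bounceTime U ε x v e) :=
  monotone_nat_of_le_succ fun k => by rw [bounceTime_succ]; exact le_self_add

lemma bounceTime_zero : bounceTime U ε x v e 0 = 0 := rfl

lemma legIndex_eq {k : ℕ} {t : NNReal} (h1 : bounceTime U ε x v e k ≤ t)
    (h2 : t < bounceTime U ε x v e (k + 1)) : legIndex U ε x v e t = k := by
  refine le_antisymm (Nat.sInf_le h2) (le_csInf ⟨k, h2⟩ fun j hj => ?_)
  by_contra! hjk
  exact absurd (hj.trans_le ((bounceTime_monotone hjk).trans h1)) (lt_irrefl _)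

/-- This also covers infinitely many bounces before `t`: the infimum of the empty set is `0`, and
bounce time `0` is `0`. -/
lemma bounceTime_legIndex_le (t : NNReal) : bounceTime U ε x v e (legIndex U ε x v e t) ≤ t := by
  rcases hk : legIndex U ε x v e t with _ | k
  · simp [bounceTime_zero]
  · by_contra! h
    have : legIndex U ε x v e t ≤ k := Nat.sInf_le h
    omega

lemma norm_skeleton_pos_sub_le (k : ℕ) (h : bounceTime U ε x v e k ≠ ⊤) :
    ‖(skeleton U ε x v e k).2.1 - x‖ ≤ (bounceTime U ε x v e k).toReal * ‖v‖ := by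
  induction k with
  | zero => simp [skeleton, bounceTime]
  | succ k ih =>
    rw [bounceTime_succ] at h ⊢
    have h1 := ENNReal.add_ne_top.1 h
    rw [ENNReal.toReal_add h1.1 h1.2, skeleton_pos_succ, add_sub_right_comm, add_mul]
    refine (norm_add_le _ _).trans (add_le_add (ih h1.1) ?_)
    rw [norm_smul, norm_skeleton_vel, Real.norm_eq_abs, abs_of_nonneg ENNReal.toReal_nonneg]

lemma norm_position_sub_le (t : NNReal) : ‖position U ε x v e t - x‖ ≤ t * ‖v‖ := by
  have h1 := bounceTime_legIndex_le (U := U) (ε := ε) (x := x) (v := v) (e := e) t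
  have h2 : bounceTime U ε x v e (legIndex U ε x v e t) ≠ ⊤ := ne_top_of_le_ne_top (by simp) h1
  have h3 : (bounceTime U ε x v e (legIndex U ε x v e t)).toReal ≤ t := by
    simpa using ENNReal.toReal_mono (by simp) h1
  have h4 := norm_skeleton_pos_sub_le _ h2
  unfold position
  simp only
  rw [add_sub_right_comm]
  refine (norm_add_le _ _).trans ((add_le_add h4 le_rfl).trans ?_)
  change _ + ‖((t : ℝ) - (bounceTime U ε x v e (legIndex U ε x v e t)).toReal) • _‖ ≤ _
  rw [norm_smul, norm_skeleton_vel, Real.norm_eq_abs, abs_of_nonneg (sub_nonneg.2 h3), ← add_mul,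
    add_sub_cancel]

lemma mem_band_of_lt_exitTime {γ : ℝ} {t : NNReal}
    (h : (t : ENNReal) < exitTime U xstar γ ε x v e) : position U ε x v e t ∈ band U xstar γ := by
  by_contra hn
  exact absurd h (not_lt.2 (iInf₂_le t hn))

/-- Up to the exit time the trajectory stays in the band, bounce points included. -/
lemma segment_mem_band (hC : ContDiff ℝ 1 U) (hε : 0 < ε) {γ : ℝ} {k : ℕ} (he : 0 < e k)
    (hfin : bounceTime U ε x v e (k + 1) ≠ ⊤)
    (hexit : bounceTime U ε x v e (k + 1) ≤ exitTime U xstar γ ε x v e) :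
    ∀ t ∈ Set.Icc 0
      (flightTime U ε (skeleton U ε x v e k).2.1 (skeleton U ε x v e k).2.2 (e k)).toReal,
      (skeleton U ε x v e k).2.1 + t • (skeleton U ε x v e k).2.2 ∈ band U xstar γ := by
  have hfin' := hfin
  rw [bounceTime_succ] at hfin'
  obtain ⟨hT, hh⟩ := ENNReal.add_ne_top.1 hfin'
  have hpos := flightTime_pos hC hε he hh
  set h := flightTime U ε (skeleton U ε x v e k).2.1 (skeleton U ε x v e k).2.2 (e k) with hdef
  set T := bounceTime U ε x v e k with hTdef
  have hIco : ∀ t ∈ Set.Ico 0 h.toReal,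
      (skeleton U ε x v e k).2.1 + t • (skeleton U ε x v e k).2.2 ∈ band U xstar γ := by
    intro t ht
    set t' : NNReal := T.toNNReal + t.toNNReal
    have ht' : (t' : ℝ) = T.toReal + t := by
      rw [NNReal.coe_add, Real.coe_toNNReal _ ht.1]; rfl
    have hcoe : (t' : ENNReal) = T + ENNReal.ofReal t := by
      rw [ENNReal.coe_add, ENNReal.coe_toNNReal hT]; rfl
    have h1 : T ≤ t' := by rw [hcoe]; exact le_self_add
    have h2 : (t' : ENNReal) < bounceTime U ε x v e (k + 1) := by
      rw [hcoe, bounceTime_succ]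
      exact ENNReal.add_lt_add_left hT ((ENNReal.ofReal_lt_iff_lt_toReal ht.1 hh).2 ht.2)
    have h3 := mem_band_of_lt_exitTime (h2.trans_le hexit)
    rw [position, legIndex_eq h1 h2] at h3
    have h4 : (t' : ℝ) - (skeleton U ε x v e k).1.toReal = t := by
      rw [ht']; simp [hTdef, bounceTime]
    simpa only [h4] using h3
  -- The exit time controls only positions strictly before the bounce. The bounce point is reached
  -- by closure, since the band is closed and the flight has positive length.
  have hclosed : IsClosed {t : ℝ |
      (skeleton U ε x v e k).2.1 + t • (skeleton U ε x v e k).2.2 ∈ band U xstar γ} := by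
    have hb : IsClosed (band U xstar γ) := (isClosed_le continuous_const hC.continuous).inter
      (isClosed_le hC.continuous continuous_const)
    exact hb.preimage (by fun_prop)
  intro t ht
  have := closure_minimal hIco hclosed
  rw [closure_Ico hpos.ne] at this
  exact this ht

/-- The speed is constantly `‖v‖`, so the path cannot leave the ball before time `r / ‖v‖`. -/
lemma le_exitTime_of_closedBall_subset {γ r D : ℝ} (hr : Metric.closedBall x r ⊆ band U xstar γ)
    (hD : D * ‖v‖ ≤ r) : ENNReal.ofReal D ≤ exitTime U xstar γ ε x v e := by
  refine le_iInf₂ fun t ht => ?_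
  by_contra! hlt
  have htD : (t : ℝ) < D := by
    rw [ENNReal.lt_ofReal_iff_toReal_lt (by simp)] at hlt
    simpa using hlt
  refine ht (hr ?_)
  rw [mem_closedBall_iff_norm]
  refine (norm_position_sub_le t).trans (le_trans ?_ hD)
  gcongr

end Skeleton

/-! ### Necessary conditions for many bounces. -/

section Upper

variable {γ m M g G ε : ℝ} {x v : Space d} {e : ℕ → ℝ}

/-- Necessary conditions for at least `k + 2` bounces before the exit from the band: the initial
slope must be small compared to the elapsed time, and the distance travelled is at least
a sum of independent contributions of order `√ε`. -/
lemma bounds_of_bounceTime_le (hB : DerivBounds U (band U xstar γ) m M g G) (hε : 0 < ε)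
    (he : ∀ k, 0 < e k) (k : ℕ) (hfin : bounceTime U ε x v e (k + 2) ≠ ⊤)
    (hexit : bounceTime U ε x v e (k + 2) ≤ exitTime U xstar γ ε x v e) :
    |slope U x v| ≤ M * ‖v‖ ^ 2 * (bounceTime U ε x v e (k + 2)).toReal ∧
    √(ε / M) * ∑ j ∈ Finset.range (k + 1), √(e (j + 1)) ≤
      ‖v‖ * (bounceTime U ε x v e (k + 2)).toReal := by
  set X : ℕ → Space d := fun j => (skeleton U ε x v e j).2.1 with hX
  set V : ℕ → Space d := fun j => (skeleton U ε x v e j).2.2 with hV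
  set h : ℕ → ℝ := fun j => (flightTime U ε (X j) (V j) (e j)).toReal with hh
  have hVn : ∀ j, ‖V j‖ = ‖v‖ := fun j => norm_skeleton_vel j
  have hle : ∀ j ≤ k + 1, bounceTime U ε x v e (j + 1) ≤ bounceTime U ε x v e (k + 2) :=
    fun j hj => bounceTime_monotone (by omega)
  have hf : ∀ j ≤ k + 1, bounceTime U ε x v e (j + 1) ≠ ⊤ :=
    fun j hj => ne_top_of_le_ne_top hfin (hle j hj)
  have hff : ∀ j ≤ k + 1, flightTime U ε (X j) (V j) (e j) ≠ ⊤ := fun j hj => by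
    have := hf j hj
    rw [bounceTime_succ] at this
    exact (ENNReal.add_ne_top.1 this).2
  have hseg : ∀ j ≤ k + 1, ∀ t ∈ Set.Icc 0 (h j), X j + t • V j ∈ band U xstar γ :=
    fun j hj => segment_mem_band hB.contDiff hε (he j) (hf j hj) ((hle j hj).trans hexit)
  have hnn : ∀ j, 0 ≤ h j := fun j => ENNReal.toReal_nonneg
  have hce : ∀ j ≤ k + 1, e j ≤ cumulativeRate U ε (X j) (V j) (h j) :=
    fun j hj => le_cumulativeRate_flightTime hB.contDiff hε (hff j hj)
  have hpos : ∀ j ≤ k + 1, 0 < slope U (X j + h j • V j) (V j) := fun j hj =>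
    slope_pos_of_le_cumulativeRate hB (he j) (hnn j) (hseg j hj) (hce j hj)
  have hflip : ∀ j, slope U (X (j + 1)) (V (j + 1)) = -slope U (X j + h j • V j) (V j) :=
    fun j => slope_bounce _ _
  have hup : ∀ j ≤ k + 1, slope U (X j + h j • V j) (V j) - slope U (X j) (V j) ≤
      M * ‖v‖ ^ 2 * h j := fun j hj => by
    simpa [hVn] using slope_sub_le hB (hseg j hj) le_rfl (hnn j) le_rfl
  have htime : ∀ j ≤ k + 1, (bounceTime U ε x v e (j + 1)).toReal =
      (bounceTime U ε x v e j).toReal + h j := fun j hj => by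
    have := hf j hj
    rw [bounceTime_succ] at this ⊢
    obtain ⟨h1, h2⟩ := ENNReal.add_ne_top.1 this
    exact ENNReal.toReal_add h1 h2
  have hMs : 0 ≤ M * ‖v‖ ^ 2 := mul_nonneg hB.M_pos.le (by positivity)
  have hM := hB.M_pos
  have htoT : ∀ j ≤ k + 1, h j ≤ (bounceTime U ε x v e (k + 2)).toReal := fun j hj => by
    have h1 := htime j hj
    have h2 := ENNReal.toReal_mono hfin (hle j hj)
    have h3 : 0 ≤ (bounceTime U ε x v e j).toReal := ENNReal.toReal_nonneg
    linarith
  constructor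
  -- A nonpositive initial slope must be overcome during the first flight. A positive one can only
  -- grow before the first bounce, then changes sign, and must be overcome during the second flight.
  -- This is why two bounces are needed before anything is learnt about the slope.
  · rcases le_or_gt (slope U x v) 0 with h0 | h0
    · rw [abs_of_nonpos h0]
      have h1 := hup 0 (by omega)
      have h2 := hpos 0 (by omega)
      have h3 := mul_le_mul_of_nonneg_left (htoT 0 (by omega)) hMs
      have h4 : slope U (X 0) (V 0) = slope U x v := rfl
      linarith
    · rw [abs_of_pos h0]
      have h1 := hup 1 (by omega)
      have h2 := hpos 1 (by omega)
      have h3 := mul_le_mul_of_nonneg_left (htoT 1 (by omega)) hMs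
      have h4 : slope U (X 0) (V 0) = slope U x v := rfl
      have h5 := hflip 0
      have h6 := le_slope_sub hB (hseg 0 (by omega)) le_rfl (hnn 0) le_rfl
      have h7 : 0 ≤ m * ‖V 0‖ ^ 2 * (h 0 - 0) :=
        mul_nonneg (mul_nonneg hB.m_pos.le (by positivity)) (by simpa using hnn 0)
      simp only [zero_smul, add_zero, zero_add] at h5 h6
      linarith
  · have hone : ∀ j ≤ k, √(ε / M) * √(e (j + 1)) ≤ ‖v‖ * h (j + 1) := fun j hj => by
      have h0 : slope U (X (j + 1)) (V (j + 1)) ≤ 0 := by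
        rw [hflip]; linarith [hpos j (by omega)]
      have h1 := mul_le_of_le_cumulativeRate hB hε (hnn (j + 1)) (hseg (j + 1) (by omega)) h0
        (hce (j + 1) (by omega))
      rw [hVn] at h1
      rw [← Real.sqrt_mul (by positivity)]
      refine Real.sqrt_le_iff.2 ⟨mul_nonneg (norm_nonneg _) (hnn _), ?_⟩
      rw [div_mul_eq_mul_div, div_le_iff₀ hM]
      linarith
    have hsum : ∀ j ≤ k + 1, √(ε / M) * ∑ i ∈ Finset.range j, √(e (i + 1)) ≤
        ‖v‖ * (bounceTime U ε x v e (j + 1)).toReal := by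
      intro j
      induction j with
      | zero => intro _; simp; positivity
      | succ j ih =>
        intro hj
        rw [Finset.sum_range_succ, mul_add, htime (j + 1) hj, mul_add]
        exact add_le_add (ih (by omega)) (hone j (by omega))
    exact hsum (k + 1) le_rfl

end Upper

/-! ### Sufficient conditions for many bounces. -/

section Lower

variable {γ m M g G ε r R D : ℝ} {x v : Space d} {e : ℕ → ℝ}

/-- One flight inside a ball where the derivative bounds hold ends before
the slope has had time to become nonnegative and to grow by the order `√ε`. -/
lemma flightTime_le_of_ball (hB : DerivBounds U (band U xstar γ) m M g G) (hε : 0 < ε)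
    {y w : Space d} {a t : ℝ} (ha : 0 ≤ a) (hw : 1 ≤ ‖w‖)
    (ht : t = max (-slope U y w) 0 / m + 2 * √(ε * a / m))
    (hseg : ∀ s ∈ Set.Icc 0 t, y + s • w ∈ band U xstar γ) :
    flightTime U ε y w a ≤ ENNReal.ofReal t := by
  have hm := hB.m_pos
  have ht0 : 0 ≤ t := by rw [ht]; positivity
  refine flightTime_le ht0 ?_
  refine le_integral_posPart (u := fun s : ℝ => slope U (y + s • w) w)
    (continuous_slope_line hB.contDiff y w) hε hm ha (by simpa using ht) fun s hs => ?_
  have h1 := le_slope_sub hB hseg le_rfl hs.1 hs.2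
  have h2 : m ≤ m * ‖w‖ ^ 2 := le_mul_of_one_le_right hm.le (one_le_pow₀ hw)
  have h3 := mul_le_mul_of_nonneg_right h2 hs.1
  simp only [sub_zero] at h1
  linarith

/-- A flight which starts with nonpositive slope ends with a slope of order `√ε`. -/
lemma slope_flightTime_le (hB : DerivBounds U (band U xstar γ) m M g G) (hε : 0 < ε)
    {y w : Space d} {a : ℝ} (ha : 0 < a) (hw : ‖w‖ ≤ R) (hR : 0 < R)
    (hfin : flightTime U ε y w a ≠ ⊤) (h0 : slope U y w ≤ 0)
    (hseg : ∀ s ∈ Set.Icc 0 (flightTime U ε y w a).toReal, y + s • w ∈ band U xstar γ) :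
    slope U (y + (flightTime U ε y w a).toReal • w) w ≤ 2 * √(M * R ^ 2 * (ε * a)) := by
  have hM := hB.M_pos
  refine le_of_integral_posPart_le (u := fun s : ℝ => slope U (y + s • w) w)
    (continuous_slope_line hB.contDiff y w) hε (by positivity) ENNReal.toReal_nonneg
    (by simpa using h0) (fun s hs => ?_) (cumulativeRate_flightTime_le hB.contDiff ha.le hfin)
  refine (slope_sub_le hB hseg hs.1 hs.2 le_rfl).trans ?_
  have h2 : M * ‖w‖ ^ 2 ≤ M * R ^ 2 := by gcongr
  exact mul_le_mul_of_nonneg_right h2 (by linarith [hs.2])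

/-- If the initial slope is nonpositive, then bounce `k` happens before a time of order
`|slope| + √ε ∑ √e`, as long as the trajectory has not left a ball inside the band. -/
lemma bounceTime_le_of_slope_nonpos (hB : DerivBounds U (band U xstar γ) m M g G) (hε : 0 < ε)
    (he : ∀ k, 0 < e k) (hr : Metric.closedBall x r ⊆ band U xstar γ) (hv1 : 1 ≤ ‖v‖)
    (hvR : ‖v‖ ≤ R) (hDr : D * R ≤ r) (h0 : slope U x v ≤ 0) (k : ℕ)
    (hD : -slope U x v / m + √ε * (2 * √m⁻¹ + 2 * √(M * R ^ 2) / m) *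
      ∑ j ∈ Finset.range k, √(e j) ≤ D) :
    bounceTime U ε x v e k ≤ ENNReal.ofReal D := by
  have hR : 0 < R := by linarith
  have hm := hB.m_pos
  have hM := hB.M_pos
  set X : ℕ → Space d := fun j => (skeleton U ε x v e j).2.1 with hX
  set V : ℕ → Space d := fun j => (skeleton U ε x v e j).2.2 with hV
  set A : ℝ := 2 * √m⁻¹ + 2 * √(M * R ^ 2) / m
  have hA : 0 ≤ A := by positivity
  -- The invariant quantity is elapsed time plus `|slope| / m`, the time still needed to bring the
  -- slope to zero. A flight pays for the old `|slope| / m` with its length. Only `2√(ε e/m)` of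
  -- extra flight time and the new slope `2√(M R² ε e)` divided by `m` are added, which gives the
  -- constant `A`.
  have key : ∀ j ≤ k, bounceTime U ε x v e j ≠ ⊤ ∧ slope U (X j) (V j) ≤ 0 ∧
      (bounceTime U ε x v e j).toReal + -slope U (X j) (V j) / m ≤
        -slope U x v / m + √ε * A * ∑ i ∈ Finset.range j, √(e i) := by
    intro j
    induction j with
    | zero => intro _; simpa [bounceTime, skeleton, hX, hV] using h0
    | succ j ih =>
      intro hj
      obtain ⟨hfin, hneg, hT⟩ := ih (by omega)
      have hmono : ∑ i ∈ Finset.range (j + 1), √(e i) ≤ ∑ i ∈ Finset.range k, √(e i) :=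
        Finset.sum_le_sum_of_subset_of_nonneg (Finset.range_mono hj) fun _ _ _ => Real.sqrt_nonneg _
      have hVn : ‖V j‖ = ‖v‖ := norm_skeleton_vel j
      set t := max (-slope U (X j) (V j)) 0 / m + 2 * √(ε * e j / m) with ht
      have hsplit1 : √(ε * e j / m) = √ε * √m⁻¹ * √(e j) := by
        rw [div_eq_mul_inv, Real.sqrt_mul (by have := he j; positivity), Real.sqrt_mul hε.le]; ring
      have hsplit2 : √(M * R ^ 2 * (ε * e j)) = √(M * R ^ 2) * √ε * √(e j) := by
        rw [Real.sqrt_mul (by positivity), Real.sqrt_mul hε.le]; ring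
      have hmax : max (-slope U (X j) (V j)) 0 = -slope U (X j) (V j) := max_eq_left (by linarith)
      have hDk : √ε * A * ∑ i ∈ Finset.range (j + 1), √(e i) ≤ D + slope U x v / m := by
        have := mul_le_mul_of_nonneg_left hmono (mul_nonneg (Real.sqrt_nonneg ε) hA)
        rw [neg_div] at hD
        linarith
      have hAsplit : √ε * A * √(e j) = 2 * (√ε * √m⁻¹ * √(e j)) +
          2 * (√(M * R ^ 2) * √ε * √(e j)) / m := by simp only [A]; ring
      have hnn2 : 0 ≤ 2 * (√(M * R ^ 2) * √ε * √(e j)) / m := by positivity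
      rw [Finset.sum_range_succ, mul_add, hAsplit] at hDk
      have ht0 : 0 ≤ t := by rw [ht]; positivity
      have htD : (bounceTime U ε x v e j).toReal + t ≤ D := by
        rw [ht, hmax, hsplit1]
        rw [neg_div (b := slope U x v)] at hT
        linarith
      have hball : ∀ s ∈ Set.Icc 0 t, X j + s • V j ∈ band U xstar γ := by
        intro s hs
        refine hr ?_
        rw [mem_closedBall_iff_norm, add_sub_right_comm]
        refine (norm_add_le _ _).trans ?_
        have h1 := norm_skeleton_pos_sub_le j hfin
        rw [norm_smul, hVn, Real.norm_eq_abs, abs_of_nonneg hs.1]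
        have h2 : ((bounceTime U ε x v e j).toReal + s) * ‖v‖ ≤ D * R := by
          have : (bounceTime U ε x v e j).toReal + s ≤ D := by linarith [hs.2]
          have h0 : 0 ≤ (bounceTime U ε x v e j).toReal + s :=
            add_nonneg ENNReal.toReal_nonneg hs.1
          exact mul_le_mul this hvR (norm_nonneg _) (h0.trans this)
        rw [add_mul] at h2
        linarith [show ‖X j - x‖ ≤ _ from h1]
      have hfl := flightTime_le_of_ball hB hε (he j).le (hVn ▸ hv1) ht hball
      have hfl_top : flightTime U ε (X j) (V j) (e j) ≠ ⊤ := ne_top_of_le_ne_top (by simp) hfl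
      have hflr : (flightTime U ε (X j) (V j) (e j)).toReal ≤ t :=
        ENNReal.toReal_le_of_le_ofReal ht0 hfl
      have hseg : ∀ s ∈ Set.Icc 0 (flightTime U ε (X j) (V j) (e j)).toReal,
          X j + s • V j ∈ band U xstar γ := fun s hs => hball s ⟨hs.1, hs.2.trans hflr⟩
      have hsl := slope_flightTime_le hB hε (he j) (hVn ▸ hvR) hR hfl_top hneg hseg
      have hsp := slope_pos_of_le_cumulativeRate hB (he j) ENNReal.toReal_nonneg hseg
        (le_cumulativeRate_flightTime hB.contDiff hε hfl_top)
      have hflip : slope U (X (j + 1)) (V (j + 1)) = -slope U (X j +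
        (flightTime U ε (X j) (V j) (e j)).toReal • V j) (V j) := slope_bounce _ _
      refine ⟨ENNReal.add_ne_top.2 ⟨hfin, hfl_top⟩, by linarith, ?_⟩
      have htime : (bounceTime U ε x v e (j + 1)).toReal = (bounceTime U ε x v e j).toReal +
        (flightTime U ε (X j) (V j) (e j)).toReal := ENNReal.toReal_add hfin hfl_top
      have hdiv := div_le_div_of_nonneg_right hsl hm.le
      rw [Finset.sum_range_succ, mul_add, hAsplit, htime, hflip, neg_neg]
      rw [ht, hmax, hsplit1] at hflr
      rw [hsplit2] at hdiv
      linarith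
  obtain ⟨h1, h2, h3⟩ := key k le_rfl
  rw [← ENNReal.ofReal_toReal h1]
  refine ENNReal.ofReal_le_ofReal ?_
  have : 0 ≤ -slope U (X k) (V k) / m := div_nonneg (by linarith) hm.le
  linarith

/-- A path that starts uphill has no negative slope to overcome, so its first bounce comes within
the `√ε` scale whatever the size of the slope. -/
lemma bounceTime_one_le (hB : DerivBounds U (band U xstar γ) m M g G) (hε : 0 < ε)
    (he : 0 < e 0) (hr : Metric.closedBall x r ⊆ band U xstar γ) (hv1 : 1 ≤ ‖v‖)
    (hvR : ‖v‖ ≤ R) (hDr : D * R ≤ r) (h0 : 0 ≤ slope U x v)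
    (hD : 2 * √(ε * e 0 / m) ≤ D) :
    bounceTime U ε x v e 1 ≤ ENNReal.ofReal D := by
  have h1 : flightTime U ε x v (e 0) ≤ ENNReal.ofReal (2 * √(ε * e 0 / m)) := by
    refine flightTime_le_of_ball hB hε he.le hv1 ?_ fun s hs => hr ?_
    · rw [max_eq_right (by linarith)]; simp
    · rw [mem_closedBall_iff_norm, add_sub_cancel_left, norm_smul, Real.norm_eq_abs,
        abs_of_nonneg hs.1]
      have : s ≤ D := hs.2.trans hD
      exact (mul_le_mul this hvR (norm_nonneg _) (hs.1.trans this)).trans hDr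
  have h2 : bounceTime U ε x v e 1 = flightTime U ε x v (e 0) := by
    rw [bounceTime_succ, bounceTime_zero, zero_add]; rfl
  rw [h2]
  exact h1.trans (ENNReal.ofReal_le_ofReal hD)

end Lower

end

/-! ### Exponential variables. -/

section Exponential

lemma expMeasure_Ici {r : ℝ} (hr : 0 < r) {a : ℝ} (ha : 0 ≤ a) :
    expMeasure r (Set.Ici a) = ENNReal.ofReal (Real.exp (-(r * a))) := by
  have := isProbabilityMeasure_expMeasure hr
  have hac : expMeasure r ≪ volume := withDensity_absolutelyContinuous _ _
  have h0 : expMeasure r {a} = 0 := hac (by simp)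
  have h1 : expMeasure r (Set.Iic a) = ENNReal.ofReal (1 - Real.exp (-(r * a))) := by
    rw [← ofReal_cdf, cdf_expMeasure_eq hr, if_pos ha]
  have h2 : expMeasure r (Set.Ici a) = expMeasure r (Set.Ioi a) := by
    refine le_antisymm ?_ (measure_mono Set.Ioi_subset_Ici_self)
    rw [← Set.Ioi_insert, Set.insert_eq]
    exact (measure_union_le _ _).trans (by rw [h0, zero_add])
  have h3 : Real.exp (-(r * a)) ≤ 1 := Real.exp_le_one_iff.2 (by nlinarith)
  rw [h2, ← Set.compl_Iic, prob_compl_eq_one_sub measurableSet_Iic, h1, ← ENNReal.ofReal_one,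
    ← ENNReal.ofReal_sub _ (by linarith)]
  congr 1
  ring

lemma ae_expMeasure_pos {r : ℝ} (hr : 0 < r) : ∀ᵐ t ∂(expMeasure r), 0 < t := by
  have := isProbabilityMeasure_expMeasure hr
  rw [ae_iff]
  have h1 : {a : ℝ | ¬0 < a} = Set.Iic 0 := by ext; simp
  rw [h1, ← ofReal_cdf, cdf_expMeasure_eq hr]
  simp

/-- Multiplying the exponential density by `tⁿ` gives `n!/rⁿ` times the Gamma density of shape `n +
1`. -/
lemma lintegral_expMeasure_pow {r : ℝ} (hr : 0 < r) (n : ℕ) :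
    ∫⁻ t, ENNReal.ofReal (max t 0 ^ n) ∂(expMeasure r) = ENNReal.ofReal (n.factorial / r ^ n) := by
  have hm : Measurable (gammaPDF 1 r) := (measurable_gammaPDFReal 1 r).ennreal_ofReal
  have hm' : Measurable (gammaPDF (n + 1) r) := (measurable_gammaPDFReal (n + 1) r).ennreal_ofReal
  rw [expMeasure, gammaMeasure, lintegral_withDensity_eq_lintegral_mul _ hm (by fun_prop)]
  have hpt : ∀ t : ℝ, (gammaPDF 1 r * fun t : ℝ => ENNReal.ofReal (max t 0 ^ n)) t =
      ENNReal.ofReal (n.factorial / r ^ n) * gammaPDF (n + 1) r t := by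
    intro t
    simp only [Pi.mul_apply, gammaPDF]
    rcases lt_or_ge t 0 with ht | ht
    · simp [gammaPDFReal, not_le.2 ht]
    rw [← ENNReal.ofReal_mul (gammaPDFReal_nonneg one_pos hr t), ← ENNReal.ofReal_mul (by positivity)]
    congr 1
    simp only [gammaPDFReal, ht, if_true, max_eq_left, Real.rpow_one, Real.Gamma_one, sub_self,
      Real.rpow_zero, add_sub_cancel_right, Real.Gamma_nat_eq_factorial, Real.rpow_natCast]
    rw [Real.rpow_add hr, Real.rpow_one, Real.rpow_natCast]
    have : (n.factorial : ℝ) ≠ 0 := by positivity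
    field_simp
  rw [lintegral_congr hpt, lintegral_const_mul _ hm', lintegral_gammaPDF_eq_one (by positivity) hr,
    mul_one]

/-- The Laplace transform of `√e`, `e` standard exponential, is at most `1 - l / 6` for small `l`. -/
lemma lintegral_exp_neg_sqrt_le {l : ℝ} (h0 : 0 ≤ l) (h1 : l ≤ 1) :
    ∫⁻ t, ENNReal.ofReal (Real.exp (-(l * √t))) ∂(expMeasure 1) ≤ ENNReal.ofReal (1 - l / 6) := by
  have := isProbabilityMeasure_expMeasure one_pos
  have hIci := expMeasure_Ici one_pos (zero_le_one' ℝ)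
  -- The integrand is at most `1` below `t = 1` and at most `exp (-l)` above, so the integral is at
  -- most `1 - exp (-1) (1 - exp (-l))`. The bounds `exp (-1) ≥ 1/3` and `1 - exp (-l) ≥ l/2` give
  -- the factor `1/6`.
  have hle : ∀ t : ℝ, ENNReal.ofReal (Real.exp (-(l * √t))) ≤
      (Set.Ici (1 : ℝ))ᶜ.indicator 1 t + (Set.Ici (1 : ℝ)).indicator
        (fun _ => ENNReal.ofReal (Real.exp (-l))) t := by
    intro t
    by_cases ht : 1 ≤ t
    · have : 1 ≤ √t := Real.one_le_sqrt.2 ht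
      simp only [Set.mem_compl_iff, Set.mem_Ici, ht, not_true_eq_false, not_false_eq_true,
        Set.indicator_of_notMem, Set.indicator_of_mem, zero_add]
      exact ENNReal.ofReal_le_ofReal (Real.exp_le_exp.2 (by nlinarith))
    · simp only [Set.mem_compl_iff, Set.mem_Ici, ht, not_false_eq_true,
        Set.indicator_of_notMem, Set.indicator_of_mem, add_zero, Pi.one_apply]
      exact ENNReal.ofReal_le_one.2 (Real.exp_le_one_iff.2 (by have := Real.sqrt_nonneg t; nlinarith))
  refine (lintegral_mono hle).trans ?_
  have he1 : Real.exp (-1) ≤ 1 := Real.exp_le_one_iff.2 (by norm_num)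
  rw [lintegral_add_right _ (measurable_const.indicator measurableSet_Ici),
    lintegral_indicator_one measurableSet_Ici.compl, lintegral_indicator measurableSet_Ici,
    setLIntegral_const, prob_compl_eq_one_sub measurableSet_Ici, hIci, mul_one,
    ← ENNReal.ofReal_one, ← ENNReal.ofReal_sub _ (Real.exp_pos _).le,
    ← ENNReal.ofReal_mul (Real.exp_pos _).le,
    ← ENNReal.ofReal_add (by linarith) (by positivity)]
  refine ENNReal.ofReal_le_ofReal ?_
  have h2 : Real.exp (-l) ≤ 1 - l / 2 := by
    have h3 : Real.exp (-l) ≤ 1 / (1 + l) := by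
      rw [Real.exp_neg, one_div]
      exact inv_anti₀ (by linarith) (by linarith [Real.add_one_le_exp l])
    refine h3.trans ?_
    rw [div_le_iff₀ (by linarith)]
    nlinarith
  have h4 : (1 : ℝ) / 3 ≤ Real.exp (-1) := by
    rw [Real.exp_neg, ← one_div]
    exact one_div_le_one_div_of_le (Real.exp_pos _) (by linarith [Real.exp_one_lt_d9])
  nlinarith

end Exponential

/-! ### Sums of square roots of the thresholds. -/

section Thresholds

/-- The law of the i.i.d. standard exponential thresholds. -/
noncomputable def thresholdLaw : Measure (ℕ → ℝ) := Measure.infinitePi fun _ : ℕ => expMeasure 1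

instance : IsProbabilityMeasure (expMeasure 1) := isProbabilityMeasure_expMeasure one_pos

instance : IsProbabilityMeasure thresholdLaw := by unfold thresholdLaw; infer_instance

lemma lintegral_thresholdLaw_eval {f : ℝ → ENNReal} (hf : Measurable f) (j : ℕ) :
    ∫⁻ e, f (e j) ∂thresholdLaw = ∫⁻ t, f t ∂(expMeasure 1) :=
  (measurePreserving_eval_infinitePi (fun _ : ℕ => expMeasure 1) j).lintegral_comp hf

lemma ae_thresholdLaw_pos : ∀ᵐ e ∂thresholdLaw, ∀ k, 0 < e k := by
  rw [ae_all_iff]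
  intro k
  exact (measurePreserving_eval_infinitePi (fun _ : ℕ => expMeasure 1) k).quasiMeasurePreserving.ae
    (ae_expMeasure_pos one_pos)

/-- Renewal bound: the expected number of partial sums of the `√e` below `L` is `O(1 + L)`. -/
lemma tsum_thresholdLaw_sum_sqrt_le {L : ℝ} (hL : 0 ≤ L) :
    ∑' k : ℕ, thresholdLaw {e | ∑ j ∈ Finset.range (k + 1), √(e (j + 1)) ≤ L} ≤
      ENNReal.ofReal (18 * (1 + L)) := by
  -- Chernoff parameter: `l L ≤ 1` keeps the prefactor below `e ≤ 3`, and the geometric series with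
  -- ratio at most `1 - l/6` sums to at most `6/l = 6 (1 + L)`.
  set l := (1 + L)⁻¹ with hl
  have hl0 : 0 < l := by positivity
  have hl1 : l ≤ 1 := inv_le_one_of_one_le₀ (by linarith)
  have hlL : l * L ≤ 1 := by rw [hl, inv_mul_le_iff₀ (by linarith)]; linarith
  set q : ENNReal := ∫⁻ t, ENNReal.ofReal (Real.exp (-(l * √t))) ∂(expMeasure 1) with hq
  have hqle : q ≤ ENNReal.ofReal (1 - l / 6) := lintegral_exp_neg_sqrt_le hl0.le hl1
  have hind : iIndepFun (fun (i : ℕ) (e : ℕ → ℝ) => ENNReal.ofReal (Real.exp (-(l * √(e i)))))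
      thresholdLaw :=
    iIndepFun_infinitePi (P := fun _ : ℕ => expMeasure 1)
      (X := fun _ t => ENNReal.ofReal (Real.exp (-(l * √t)))) fun _ => by fun_prop
  have hterm : ∀ k : ℕ, thresholdLaw {e | ∑ j ∈ Finset.range (k + 1), √(e (j + 1)) ≤ L} ≤
      ENNReal.ofReal 3 * q ^ k := by
    intro k
    have hmeas : MeasurableSet {e : ℕ → ℝ | ∑ j ∈ Finset.range (k + 1), √(e (j + 1)) ≤ L} :=
      measurableSet_le (by fun_prop) measurable_const
    rw [← lintegral_indicator_one hmeas]
    have hpt : ∀ e : ℕ → ℝ,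
        {e : ℕ → ℝ | ∑ j ∈ Finset.range (k + 1), √(e (j + 1)) ≤ L}.indicator 1 e ≤
        ENNReal.ofReal 3 *
          ∏ i ∈ (Finset.range (k + 1)).image Nat.succ, ENNReal.ofReal (Real.exp (-(l * √(e i)))) := by
      intro e
      refine Set.indicator_apply_le' (fun he => ?_) fun _ => zero_le
      rw [← ENNReal.ofReal_prod_of_nonneg fun _ _ => (Real.exp_pos _).le,
        Finset.prod_image fun _ _ _ _ h => Nat.succ_injective h,
        ← Real.exp_sum, ← ENNReal.ofReal_mul (by norm_num), Pi.one_apply, ← ENNReal.ofReal_one]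
      refine ENNReal.ofReal_le_ofReal ?_
      rw [Finset.sum_neg_distrib, ← Finset.mul_sum]
      have h1 : l * ∑ j ∈ Finset.range (k + 1), √(e (j + 1)) ≤ 1 :=
        (mul_le_mul_of_nonneg_left he hl0.le).trans hlL
      have h2 : Real.exp (-1) ≤ Real.exp (-(l * ∑ j ∈ Finset.range (k + 1), √(e (j + 1)))) :=
        Real.exp_le_exp.2 (by linarith)
      have h4 : (1 : ℝ) / 3 ≤ Real.exp (-1) := by
        rw [Real.exp_neg, ← one_div]
        exact one_div_le_one_div_of_le (Real.exp_pos _) (by linarith [Real.exp_one_lt_d9])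
      simp only [Nat.succ_eq_add_one]
      linarith
    refine (lintegral_mono hpt).trans ?_
    rw [lintegral_const_mul _ (by fun_prop),
      lintegral_prod_eq_prod_lintegral_of_indepFun _ _ hind fun _ => by fun_prop]
    simp only [lintegral_thresholdLaw_eval
      (f := fun t => ENNReal.ofReal (Real.exp (-(l * √t)))) (by fun_prop)]
    rw [Finset.prod_const, Finset.card_image_of_injective _ Nat.succ_injective, Finset.card_range,
      ← hq, pow_succ]
    have hq1 : q ≤ 1 := hqle.trans (ENNReal.ofReal_le_one.2 (by linarith))
    gcongr
    exact mul_le_of_le_one_right' hq1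
  refine (ENNReal.tsum_le_tsum hterm).trans ?_
  rw [ENNReal.tsum_mul_left, ENNReal.tsum_geometric]
  have h1 : ENNReal.ofReal (l / 6) ≤ 1 - q := by
    refine le_trans ?_ (tsub_le_tsub_left hqle 1)
    rw [← ENNReal.ofReal_one, ← ENNReal.ofReal_sub _ (by linarith)]
    exact ENNReal.ofReal_le_ofReal (by linarith)
  calc ENNReal.ofReal 3 * (1 - q)⁻¹ ≤ ENNReal.ofReal 3 * (ENNReal.ofReal (l / 6))⁻¹ := by
        gcongr
    _ = ENNReal.ofReal (18 * (1 + L)) := by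
        rw [← ENNReal.ofReal_inv_of_pos (by positivity), ← ENNReal.ofReal_mul (by norm_num)]
        congr 1
        rw [hl]; field_simp; norm_num

/-- With probability at least one half, the sum of `k` of the `√e` is at most `2 k`. -/
lemma half_le_thresholdLaw_sum_sqrt (k : ℕ) :
    ENNReal.ofReal (1 / 2) ≤ thresholdLaw {e | ∑ j ∈ Finset.range k, √(e j) ≤ 2 * k} := by
  rcases k.eq_zero_or_pos with rfl | hk
  · simp
  have hk' : (0 : ℝ) < k := by exact_mod_cast hk
  have hone : ∫⁻ t, ENNReal.ofReal (√t) ∂(expMeasure 1) ≤ 1 := by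
    -- Since `√t ≤ (1 + t)/2` for `t ≥ 0`, the mean of `√e` is at most `1`. Markov's inequality at
    -- level `2k` then finishes.
    have hpt : ∀ t : ℝ, ENNReal.ofReal (√t) ≤
        ENNReal.ofReal (1 / 2) * (1 + ENNReal.ofReal (max t 0 ^ 1)) := by
      intro t
      rw [← ENNReal.ofReal_one, ← ENNReal.ofReal_add zero_le_one (by positivity),
        ← ENNReal.ofReal_mul (by norm_num)]
      refine ENNReal.ofReal_le_ofReal ?_
      rw [pow_one]
      rcases le_total t 0 with h | h
      · rw [Real.sqrt_eq_zero_of_nonpos h]; positivity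
      · rw [max_eq_left h]
        nlinarith [Real.sq_sqrt h, sq_nonneg (√t - 1)]
    refine (lintegral_mono hpt).trans ?_
    rw [lintegral_const_mul _ (by fun_prop), lintegral_add_right _ (by fun_prop),
      lintegral_expMeasure_pow one_pos]
    simp only [lintegral_const, measure_univ, mul_one, Nat.factorial_one, Nat.cast_one, pow_one,
      div_one]
    rw [← ENNReal.ofReal_one, ← ENNReal.ofReal_add zero_le_one zero_le_one,
      ← ENNReal.ofReal_mul (by norm_num)]
    norm_num
  set S : Set (ℕ → ℝ) := {e | ∑ j ∈ Finset.range k, √(e j) ≤ 2 * k}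
  have hS : MeasurableSet S := measurableSet_le (by fun_prop) measurable_const
  have hcompl : thresholdLaw Sᶜ ≤ ENNReal.ofReal (1 / 2) := by
    have h1 : Sᶜ ⊆ {e | ENNReal.ofReal (2 * k) ≤ ∑ j ∈ Finset.range k, ENNReal.ofReal (√(e j))} := by
      intro e he
      have : 2 * (k : ℝ) < ∑ j ∈ Finset.range k, √(e j) := not_le.1 he
      rw [Set.mem_ofPred_eq, ← ENNReal.ofReal_sum_of_nonneg fun _ _ => Real.sqrt_nonneg _]
      exact ENNReal.ofReal_le_ofReal this.le
    have h2 := meas_ge_le_lintegral_div (μ := thresholdLaw)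
      (f := fun e : ℕ → ℝ => ∑ j ∈ Finset.range k, ENNReal.ofReal (√(e j)))
      (Measurable.aemeasurable (by fun_prop)) (ε := ENNReal.ofReal (2 * k))
      (ENNReal.ofReal_pos.2 (by positivity)).ne' ENNReal.ofReal_ne_top
    refine (measure_mono h1).trans (h2.trans ?_)
    rw [lintegral_finsetSum _ (by fun_prop)]
    simp only [lintegral_thresholdLaw_eval (f := fun t => ENNReal.ofReal (√t)) (by fun_prop)]
    rw [Finset.sum_const, Finset.card_range, nsmul_eq_mul]
    refine ENNReal.div_le_of_le_mul ?_
    rw [← ENNReal.ofReal_mul (by norm_num)]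
    calc (k : ENNReal) * _ ≤ k * 1 := by gcongr
      _ = ENNReal.ofReal k := by simp
      _ = _ := by congr 1; ring
  have h3 := prob_add_prob_compl (μ := thresholdLaw) hS
  have h4 : (1 : ENNReal) = ENNReal.ofReal (1 / 2) + ENNReal.ofReal (1 / 2) := by
    rw [← ENNReal.ofReal_add (by norm_num) (by norm_num)]; norm_num
  rw [h4] at h3
  have h5 : ENNReal.ofReal (1 / 2) + ENNReal.ofReal (1 / 2) ≤
      thresholdLaw S + ENNReal.ofReal (1 / 2) := by
    rw [← h3]; gcongr
  exact (ENNReal.add_le_add_iff_right (by simp)).1 h5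

end Thresholds

/-! ### Gaussian estimates for slabs. -/

section Gaussian

lemma le_gaussianReal_Icc {a b : ℝ} (ha : -2 ≤ a) (hb : b ≤ 2) :
    ENNReal.ofReal (gaussianPDFReal 0 1 2 * (b - a)) ≤ gaussianReal 0 1 (Set.Icc a b) := by
  rw [gaussianReal_apply _ one_ne_zero]
  calc ENNReal.ofReal (gaussianPDFReal 0 1 2 * (b - a))
      = ∫⁻ _ in Set.Icc a b, ENNReal.ofReal (gaussianPDFReal 0 1 2) := by
        rw [setLIntegral_const, Real.volume_Icc, ENNReal.ofReal_mul (gaussianPDFReal_nonneg _ _ _)]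
    _ ≤ _ := by
        refine setLIntegral_mono (measurable_gaussianPDF 0 1) fun x hx => ?_
        refine ENNReal.ofReal_le_ofReal ?_
        simp only [gaussianPDFReal]
        refine mul_le_mul_of_nonneg_left (Real.exp_le_exp.2 ?_) (by positivity)
        simp only [sub_zero, NNReal.coe_one, mul_one]
        nlinarith [hx.1, hx.2]

lemma gaussianReal_abs_le (y : ℝ) :
    gaussianReal 0 1 {a | |a| ≤ y} ≤ ENNReal.ofReal (2 * y) := by
  have h : {a : ℝ | |a| ≤ y} = Set.Icc (-y) y := by ext; simp [abs_le]
  rw [gaussianReal_apply _ one_ne_zero, h]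
  calc ∫⁻ x in Set.Icc (-y) y, gaussianPDF 0 1 x ≤ ∫⁻ _ in Set.Icc (-y) y, 1 := by
        refine setLIntegral_mono measurable_const fun x _ => ?_
        rw [gaussianPDF, ← ENNReal.ofReal_one]
        refine ENNReal.ofReal_le_ofReal ?_
        simp only [gaussianPDFReal]
        refine mul_le_one₀ (inv_le_one_of_one_le₀ ?_) (Real.exp_pos _).le
          (Real.exp_le_one_iff.2 ?_)
        · rw [Real.one_le_sqrt]
          simp only [NNReal.coe_one, mul_one]
          linarith [Real.pi_gt_three]
        · simp only [NNReal.coe_one, mul_one]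
          have := sq_nonneg (x - 0)
          linarith
    _ = _ := by
        rw [setLIntegral_const, Real.volume_Icc, one_mul]
        congr 1
        ring

/-- The law of the pair (component along a unit vector, squared norm) under the standard Gaussian. -/
lemma lintegral_stdGaussian_inner_norm {k : ℕ} {n : Space (k + 1)} (hn : ‖n‖ = 1)
    {F : ℝ → ℝ → ENNReal} (hF : Measurable (Function.uncurry F)) :
    ∫⁻ v, F (inner ℝ n v) (‖v‖ ^ 2) ∂(stdGaussian (Space (k + 1))) =
      ∫⁻ z, ∫⁻ a, F a (a ^ 2 + ∑ i, z i ^ 2) ∂(gaussianReal 0 1)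
        ∂(Measure.pi fun _ : Fin k => gaussianReal 0 1) := by
  -- In an orthonormal basis whose first vector is `n`, the coordinates of `v` are independent
  -- standard Gaussians and `‖v‖²` is the sum of their squares.
  obtain ⟨b, hb⟩ := Orthonormal.exists_orthonormalBasis_extension_of_card_eq (𝕜 := ℝ)
    (E := Space (k + 1)) (ι := Fin (k + 1)) (by simp) (v := fun _ => n) (s := {0})
    (orthonormal_iff_ite.2 fun i j => by
      have : i = j := Subsingleton.elim _ _
      simp [this, hn])
  have hb0 : b 0 = n := hb 0 rfl
  have hmeas : Measurable fun v : Space (k + 1) => F (inner ℝ n v) (‖v‖ ^ 2) :=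
    hF.comp (f := fun v : Space (k + 1) => (inner ℝ n v, ‖v‖ ^ 2)) (by fun_prop)
  rw [stdGaussian_eq_map_pi_orthonormalBasis b, lintegral_map hmeas (by fun_prop)]
  have hpt : ∀ x : Fin (k + 1) → ℝ, F (inner ℝ n (∑ i, x i • b i)) (‖∑ i, x i • b i‖ ^ 2) =
      (fun p : ℝ × (Fin k → ℝ) => F p.1 (p.1 ^ 2 + ∑ i, p.2 i ^ 2))
        (MeasurableEquiv.piFinSuccAbove (fun _ => ℝ) 0 x) := by
    intro x
    have h1 : ∀ j, inner ℝ (b j) (∑ i, x i • b i) = x j := fun j => by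
      rw [b.orthonormal.inner_right_fintype]
    rw [← hb0, h1, ← b.sum_sq_inner_right]
    simp only [h1]
    rw [Fin.sum_univ_succ]
    rfl
  have hmeas2 : Measurable fun p : ℝ × (Fin k → ℝ) => F p.1 (p.1 ^ 2 + ∑ i, p.2 i ^ 2) :=
    hF.comp (f := fun p : ℝ × (Fin k → ℝ) => (p.1, p.1 ^ 2 + ∑ i, p.2 i ^ 2)) (by fun_prop)
  rw [lintegral_congr hpt,
    (measurePreserving_piFinSuccAbove (fun _ : Fin (k + 1) => gaussianReal 0 1) 0).lintegral_comp
      hmeas2, lintegral_prod_symm' _ hmeas2]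

/-- A slab of width `η` meets a fixed annulus with Gaussian probability at least of order `η`. -/
lemma exists_le_stdGaussian_slab {d : ℕ} (hd : 2 ≤ d) :
    ∃ c > 0, ∃ R ≥ 1, ∀ n : Space d, ‖n‖ = 1 → ∀ η : ℝ, 0 ≤ η → η ≤ 1 →
      ENNReal.ofReal (c * η) ≤ stdGaussian (Space d)
        {v | inner ℝ n v ∈ Set.Icc (-η) 0 ∧ 1 ≤ ‖v‖ ∧ ‖v‖ ≤ R} := by
  obtain ⟨k, rfl⟩ : ∃ k, d = k + 1 := ⟨d - 1, by omega⟩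
  have hk : 1 ≤ k := by omega
  set c0 := gaussianPDFReal 0 1 2
  have hc0 : 0 < c0 := gaussianPDFReal_pos _ _ _ one_ne_zero
  refine ⟨c0 ^ k * c0, by positivity, k + 2, ?_, fun n hn η h0 h1 => ?_⟩
  · linarith [Nat.cast_nonneg (α := ℝ) k]
  set F : ℝ → ℝ → ENNReal := fun a q =>
    {p : ℝ × ℝ | p.1 ∈ Set.Icc (-η) 0 ∧ 1 ≤ p.2 ∧ p.2 ≤ (k + 2 : ℝ) ^ 2}.indicator 1 (a, q) with hF
  have hset : MeasurableSet {p : ℝ × ℝ | p.1 ∈ Set.Icc (-η) 0 ∧ 1 ≤ p.2 ∧ p.2 ≤ (k + 2 : ℝ) ^ 2} :=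
    (measurable_fst measurableSet_Icc).inter
      ((measurableSet_le measurable_const measurable_snd).inter
        (measurableSet_le measurable_snd measurable_const))
  have hFm : Measurable (Function.uncurry F) := measurable_one.indicator hset
  have hS : MeasurableSet {v : Space (k + 1) |
      inner ℝ n v ∈ Set.Icc (-η) 0 ∧ 1 ≤ ‖v‖ ∧ ‖v‖ ≤ k + 2} :=
    ((by fun_prop : Measurable fun v : Space (k + 1) => inner ℝ n v) measurableSet_Icc).inter
      ((measurableSet_le measurable_const measurable_norm).inter
        (measurableSet_le measurable_norm measurable_const))
  have heq : ∀ v : Space (k + 1), {v : Space (k + 1) |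
      inner ℝ n v ∈ Set.Icc (-η) 0 ∧ 1 ≤ ‖v‖ ∧ ‖v‖ ≤ k + 2}.indicator 1 v =
      F (inner ℝ n v) (‖v‖ ^ 2) := by
    intro v
    have e1 : (1 ≤ ‖v‖ ^ 2) ↔ 1 ≤ ‖v‖ := one_le_sq_iff₀ (norm_nonneg _)
    have e2 : (‖v‖ ^ 2 ≤ (k + 2 : ℝ) ^ 2) ↔ ‖v‖ ≤ k + 2 :=
      sq_le_sq₀ (norm_nonneg _) (by positivity)
    simp only [hF, Set.indicator_apply, Set.mem_ofPred_eq, e1, e2, Pi.one_apply]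
  rw [← lintegral_indicator_one hS, lintegral_congr heq, lintegral_stdGaussian_inner_norm hn hFm]
  -- Restricting the `k` other coordinates to `[1, 2]` keeps `‖v‖²` between `k` and `4k + 1 ≤ (k +
  -- 2)²`. The lower bound `1` needs `k ≥ 1`, that is, `d ≥ 2`.
  have hle : ∀ (z : Fin k → ℝ) (a : ℝ), (Set.univ.pi fun _ : Fin k => Set.Icc (1 : ℝ) 2).indicator 1 z *
      (Set.Icc (-η) 0).indicator (1 : ℝ → ENNReal) a ≤ F a (a ^ 2 + ∑ i, z i ^ 2) := by
    intro z a
    by_cases hz : z ∈ Set.univ.pi fun _ : Fin k => Set.Icc (1 : ℝ) 2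
    · by_cases ha : a ∈ Set.Icc (-η) 0
      · have hmem : (a, a ^ 2 + ∑ i, z i ^ 2) ∈
            {p : ℝ × ℝ | p.1 ∈ Set.Icc (-η) 0 ∧ 1 ≤ p.2 ∧ p.2 ≤ (k + 2 : ℝ) ^ 2} := by
          have hz1 : ∀ i, 1 ≤ z i ^ 2 := fun i => by nlinarith [(hz i trivial).1]
          have hz2 : ∀ i, z i ^ 2 ≤ 4 := fun i => by nlinarith [(hz i trivial).1, (hz i trivial).2]
          have s1 : (k : ℝ) ≤ ∑ i, z i ^ 2 := by
            simpa using Finset.sum_le_sum (s := Finset.univ) fun i _ => hz1 i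
          have s2 : ∑ i, z i ^ 2 ≤ k * 4 := by
            simpa using Finset.sum_le_sum (s := Finset.univ) fun i _ => hz2 i
          have hk' : (1 : ℝ) ≤ k := by exact_mod_cast hk
          refine ⟨ha, ?_, ?_⟩
          · nlinarith [sq_nonneg a]
          · have : a ^ 2 ≤ 1 := by nlinarith [ha.1, ha.2]
            show a ^ 2 + ∑ i, z i ^ 2 ≤ (k + 2 : ℝ) ^ 2
            nlinarith
        simp only [hF, Set.indicator_of_mem hmem, Set.indicator_of_mem hz, Set.indicator_of_mem ha]
        simp
      · simp [Set.indicator_of_notMem ha]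
    · rw [Set.indicator_of_notMem hz, zero_mul]
      exact zero_le
  refine le_trans ?_ (lintegral_mono fun z => lintegral_mono fun a => hle z a)
  have hpi : MeasurableSet (Set.univ.pi fun _ : Fin k => Set.Icc (1 : ℝ) 2) :=
    MeasurableSet.univ_pi fun _ => measurableSet_Icc
  have hm1 : Measurable ((Set.Icc (-η) 0).indicator (1 : ℝ → ENNReal)) :=
    measurable_one.indicator measurableSet_Icc
  have hm2 : Measurable ((Set.univ.pi fun _ : Fin k => Set.Icc (1 : ℝ) 2).indicator
      (1 : (Fin k → ℝ) → ENNReal)) := measurable_one.indicator hpi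
  simp only [lintegral_const_mul _ hm1]
  rw [lintegral_mul_const _ hm2, lintegral_indicator_one measurableSet_Icc,
    lintegral_indicator_one hpi, Measure.pi_pi, Finset.prod_const, Finset.card_univ,
    Fintype.card_fin, mul_assoc, ENNReal.ofReal_mul (by positivity), ENNReal.ofReal_pow hc0.le]
  gcongr
  · have := le_gaussianReal_Icc (a := 1) (b := 2) (by norm_num) le_rfl
    norm_num at this
    exact this
  · have := le_gaussianReal_Icc (a := -η) (b := 0) (by linarith) (by norm_num)
    simpa using this

lemma lintegral_gaussian_sum_sq_lt_top (k : ℕ) :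
    ∫⁻ z, ENNReal.ofReal (7 * ∑ i, z i ^ 2 + 4 * (∑ i, z i ^ 2) ^ 2)
      ∂(Measure.pi fun _ : Fin k => gaussianReal 0 1) < ⊤ := by
  have hp : ∀ n : ℕ, n ≠ 0 → ∀ i : Fin k, Integrable (fun z : Fin k → ℝ => ‖z i‖ ^ n)
      (Measure.pi fun _ : Fin k => gaussianReal 0 1) := fun n hn i => by
    have h1 : Integrable (fun a : ℝ => ‖id a‖ ^ n) (gaussianReal 0 1) :=
      (memLp_id_gaussianReal (n : NNReal)).integrable_norm_pow hn
    exact (measurePreserving_eval (fun _ : Fin k => gaussianReal 0 1) i).integrable_comp_of_integrable h1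
  have h : Integrable (fun z : Fin k → ℝ => 7 * ∑ i, ‖z i‖ ^ 2 + 4 * (k * ∑ i, ‖z i‖ ^ 4))
      (Measure.pi fun _ : Fin k => gaussianReal 0 1) :=
    ((integrable_finsetSum _ fun i _ => hp 2 (by norm_num) i).const_mul 7).add
      (((integrable_finsetSum _ fun i _ => hp 4 (by norm_num) i).const_mul _).const_mul 4)
  refine lt_of_le_of_lt (lintegral_mono fun z => ?_) h.lintegral_lt_top
  refine ENNReal.ofReal_le_ofReal ?_
  have h1 := sq_sum_le_card_mul_sum_sq (s := Finset.univ) (f := fun i : Fin k => z i ^ 2)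
  have h2 : ∀ i, (z i ^ 2) ^ 2 = ‖z i‖ ^ 4 := fun i => by
    rw [← pow_mul, Real.norm_eq_abs, Even.pow_abs (by decide)]
  simp only [h2, Finset.card_univ, Fintype.card_fin] at h1
  simp only [Real.norm_eq_abs, sq_abs] at h1 ⊢
  linarith

/-- If `|a| > 2tq`, the constraint `|a| ≤ t(a² + q)` forces `2t|a| ≥ 1`, and the norm is at most
`2t|a|` times itself, hence `O(t(a² + q))`. Otherwise `a` lies in a slab of width `O(tq)`. After
integration every term is linear in `t`. -/
lemma norm_indicator_le {a q t : ℝ} (hq : 0 ≤ q) (ht : 0 ≤ t) :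
    {p : ℝ × ℝ | |p.1| ≤ t * p.2}.indicator (fun p => ENNReal.ofReal (√p.2)) (a, a ^ 2 + q) ≤
      ENNReal.ofReal (1 + q) * {a : ℝ | |a| ≤ 2 * t * q}.indicator 1 a +
        (ENNReal.ofReal (2 * t) * ENNReal.ofReal (a ^ 2) + ENNReal.ofReal (3 * t * q)) := by
  refine Set.indicator_apply_le' (fun h => ?_) fun _ => zero_le
  have h : |a| ≤ t * (a ^ 2 + q) := h
  have hsq : √(a ^ 2 + q) ^ 2 = a ^ 2 + q := Real.sq_sqrt (by positivity)
  have hs0 := Real.sqrt_nonneg (a ^ 2 + q)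
  have habs := sq_abs a
  have ha0 := abs_nonneg a
  rw [← ENNReal.ofReal_mul (by positivity), ← ENNReal.ofReal_add (by positivity) (by positivity)]
  by_cases hc : |a| ≤ 2 * t * q
  · rw [Set.indicator_of_mem (by exact hc), Pi.one_apply, mul_one,
      ← ENNReal.ofReal_add (by positivity) (by positivity)]
    refine ENNReal.ofReal_le_ofReal ?_
    have : √(a ^ 2 + q) ≤ |a| + (1 + q) := by
      refine Real.sqrt_le_iff.2 ⟨by positivity, ?_⟩
      nlinarith [mul_nonneg ha0 hq]
    have : 0 ≤ 2 * t * a ^ 2 + t * q := by positivity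
    linarith
  · rw [Set.indicator_of_notMem (by exact hc), mul_zero, zero_add]
    refine ENNReal.ofReal_le_ofReal ?_
    rw [not_le] at hc
    have hpos : 0 < |a| := lt_of_le_of_lt (by positivity) hc
    have h1 : 1 ≤ 2 * t * |a| := by
      by_contra! h2
      nlinarith
    have h3 : √(a ^ 2 + q) ≤ √(a ^ 2 + q) * (2 * t * |a|) := le_mul_of_one_le_right hs0 h1
    have h4 : 2 * (√(a ^ 2 + q) * |a|) ≤ (a ^ 2 + q) + a ^ 2 := by
      nlinarith [sq_nonneg (√(a ^ 2 + q) - |a|)]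
    have h5 := mul_le_mul_of_nonneg_left h4 ht
    have h6 : 0 ≤ t * q := by positivity
    linarith

/-- The Gaussian mass of `‖v‖` on the region `|⟨n, v⟩| ≤ t ‖v‖²` is `O(t)`. -/
lemma exists_lintegral_norm_slab_le {d : ℕ} (hd : 1 ≤ d) :
    ∃ C ≥ 0, ∀ n : Space d, ‖n‖ = 1 → ∀ t : ℝ, 0 ≤ t →
      ∫⁻ v, {v : Space d | |inner ℝ n v| ≤ t * ‖v‖ ^ 2}.indicator (fun v => ENNReal.ofReal ‖v‖) v
        ∂(stdGaussian (Space d)) ≤ ENNReal.ofReal (C * t) := by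
  obtain ⟨k, rfl⟩ : ∃ k, d = k + 1 := ⟨d - 1, by omega⟩
  set I := ∫⁻ z, ENNReal.ofReal (7 * ∑ i, z i ^ 2 + 4 * (∑ i, z i ^ 2) ^ 2)
      ∂(Measure.pi fun _ : Fin k => gaussianReal 0 1) with hI
  have hIfin : I < ⊤ := lintegral_gaussian_sum_sq_lt_top k
  set J := ∫⁻ a, ENNReal.ofReal (a ^ 2) ∂(gaussianReal 0 1) with hJ
  have hJfin : J < ⊤ := by
    have h1 : Integrable (fun a : ℝ => ‖id a‖ ^ 2) (gaussianReal 0 1) :=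
      (memLp_id_gaussianReal (2 : NNReal)).integrable_norm_pow two_ne_zero
    simpa [hJ] using h1.lintegral_lt_top
  refine ⟨(I + 2 * J).toReal, ENNReal.toReal_nonneg, fun n hn t ht => ?_⟩
  set F : ℝ → ℝ → ENNReal := fun a q =>
    {p : ℝ × ℝ | |p.1| ≤ t * p.2}.indicator (fun p => ENNReal.ofReal (√p.2)) (a, q) with hF
  have hFm : Measurable (Function.uncurry F) :=
    Measurable.indicator (f := fun p : ℝ × ℝ => ENNReal.ofReal (√p.2)) (by fun_prop)
      (measurableSet_le (by fun_prop) (by fun_prop))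
  have heq : ∀ v : Space (k + 1), {v : Space (k + 1) | |inner ℝ n v| ≤ t * ‖v‖ ^ 2}.indicator
      (fun v => ENNReal.ofReal ‖v‖) v = F (inner ℝ n v) (‖v‖ ^ 2) := by
    intro v
    simp only [hF, Set.indicator_apply, Set.mem_ofPred_eq, Real.sqrt_sq (norm_nonneg _)]
  rw [lintegral_congr heq, lintegral_stdGaussian_inner_norm hn hFm]
  -- The slab `|a| ≤ 2tq` has mass at most `4tq`, and `(1 + q) · 4tq + 3tq = t (7q + 4q²)`.
  have hinner : ∀ z : Fin k → ℝ, ∫⁻ a, F a (a ^ 2 + ∑ i, z i ^ 2) ∂(gaussianReal 0 1) ≤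
      ENNReal.ofReal t * ENNReal.ofReal (7 * ∑ i, z i ^ 2 + 4 * (∑ i, z i ^ 2) ^ 2) +
        ENNReal.ofReal t * (2 * J) := by
    intro z
    set q := ∑ i, z i ^ 2
    have hq : 0 ≤ q := Finset.sum_nonneg fun _ _ => sq_nonneg _
    have hms : MeasurableSet {a : ℝ | |a| ≤ 2 * t * q} :=
      measurableSet_le (by fun_prop) (by fun_prop)
    refine (lintegral_mono fun a => norm_indicator_le hq ht).trans ?_
    rw [lintegral_add_right _ (by fun_prop), lintegral_add_right _ (by fun_prop),
      lintegral_const_mul _ (measurable_one.indicator hms), lintegral_indicator_one hms,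
      lintegral_const_mul _ (by fun_prop), lintegral_const, measure_univ, mul_one, ← hJ]
    calc _ ≤ ENNReal.ofReal (1 + q) * ENNReal.ofReal (2 * (2 * t * q)) +
          (ENNReal.ofReal (2 * t) * J + ENNReal.ofReal (3 * t * q)) := by
          gcongr
          exact gaussianReal_abs_le _
      _ = _ := by
          rw [show 2 * t = t * 2 by ring, ENNReal.ofReal_mul ht, ENNReal.ofReal_ofNat, mul_assoc _ _ J,
            add_comm (_ * _) (ENNReal.ofReal (3 * t * q)), ← add_assoc,
            ← ENNReal.ofReal_mul (by positivity), ← ENNReal.ofReal_add (by positivity) (by positivity),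
            ← ENNReal.ofReal_mul ht]
          congr 2
          ring
  refine (lintegral_mono hinner).trans ?_
  rw [lintegral_add_right _ measurable_const, lintegral_const_mul _ (by fun_prop), lintegral_const,
    measure_univ, mul_one, ← hI, ← mul_add, mul_comm, ENNReal.ofReal_mul ENNReal.toReal_nonneg,
    ENNReal.ofReal_toReal]
  exact ENNReal.add_ne_top.2 ⟨hIfin.ne, ENNReal.mul_ne_top (by simp) hJfin.ne⟩

end Gaussian

/-! ### Bounds for the expected number of bounces. -/

section

variable {d : ℕ} {U : Space d → ℝ} {xstar : Space d} {γ m M g G ε ρ : ℝ} {x : Space d}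

lemma ae_driveLaw_pos (hρ : 0 < ρ) : ∀ᵐ ω ∂(driveLaw d ρ), ∀ k, 0 < ω.2.2 k := by
  have := isProbabilityMeasure_expMeasure hρ
  have h1 : Measure.QuasiMeasurePreserving (fun ω : Space d × ℝ × (ℕ → ℝ) => ω.2.2)
      (driveLaw d ρ) thresholdLaw :=
    (Measure.quasiMeasurePreserving_snd (μ := expMeasure ρ) (ν := thresholdLaw)).comp
      (Measure.quasiMeasurePreserving_snd (μ := stdGaussian (Space d))
        (ν := (expMeasure ρ).prod thresholdLaw))
  exact h1.ae ae_thresholdLaw_pos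

lemma inner_unitNormal_le (hB : DerivBounds U (band U xstar γ) m M g G) (hx : x ∈ band U xstar γ)
    {v : Space d} {t : ℝ} (h : |slope U x v| ≤ M * ‖v‖ ^ 2 * t) :
    |inner ℝ (unitNormal U x) v| ≤ M / g * t * ‖v‖ ^ 2 := by
  rw [slope_eq_norm_mul, abs_mul, abs_norm] at h
  have h1 := mul_le_mul_of_nonneg_right (hB.gradient_lower x hx)
    (abs_nonneg (inner ℝ (unitNormal U x) v))
  have h2 := hB.g_pos
  rw [div_mul_eq_mul_div, div_mul_eq_mul_div, le_div_iff₀ h2]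
  linarith

/-- The event, in terms of the driving randomness, that contains `{N ≥ k + 2}`. -/
def lateBounceSet (n : Space d) (κ l : ℝ) (k : ℕ) : Set (Space d × ℝ × (ℕ → ℝ)) :=
  {ω | |inner ℝ n ω.1| ≤ κ * max ω.2.1 0 * ‖ω.1‖ ^ 2 ∧
    ∑ j ∈ Finset.range (k + 1), √(ω.2.2 (j + 1)) ≤ l * max ω.2.1 0 * ‖ω.1‖}

lemma measurableSet_lateBounceSet (n : Space d) (κ l : ℝ) (k : ℕ) :
    MeasurableSet (lateBounceSet n κ l k) := by
  have h1 : MeasurableSet {ω : Space d × ℝ × (ℕ → ℝ) |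
      |inner ℝ n ω.1| ≤ κ * max ω.2.1 0 * ‖ω.1‖ ^ 2} :=
    measurableSet_le (by fun_prop) (by fun_prop)
  have h2 : MeasurableSet {ω : Space d × ℝ × (ℕ → ℝ) |
      ∑ j ∈ Finset.range (k + 1), √(ω.2.2 (j + 1)) ≤ l * max ω.2.1 0 * ‖ω.1‖} :=
    measurableSet_le (by fun_prop) (by fun_prop)
  exact h1.inter h2

lemma bounceCount_le (hB : DerivBounds U (band U xstar γ) m M g G) (hε : 0 < ε)
    (hx : x ∈ band U xstar γ) {v : Space d} {t : ℝ} {e : ℕ → ℝ} (he : ∀ k, 0 < e k) :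
    (bounceCount U xstar γ ε x v e (ENNReal.ofReal t) : ENNReal) ≤
      1 + ∑' k : ℕ, (lateBounceSet (unitNormal U x) (M / g) (√(M / ε)) k).indicator 1 (v, t, e) := by
  have hM := hB.M_pos
  -- Index `k` of the counting set stands for bounce `k + 1`. The term of index `0` is bounded by
  -- `1`, and index `k + 1` is bounce `k + 2`, to which `bounds_of_bounceTime_le` applies.
  rw [bounceCount, ← ENNReal.tsum_set_one, tsum_subtype _ (fun _ => (1 : ENNReal)),
    tsum_eq_zero_add' ENNReal.summable]
  refine add_le_add (Set.indicator_le_self' (fun _ _ => zero_le) 0) (ENNReal.tsum_le_tsum fun k => ?_)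
  refine Set.indicator_apply_le' (fun hk => ?_) fun _ => zero_le
  have h1 : bounceTime U ε x v e (k + 2) ≤ ENNReal.ofReal t := hk.trans (min_le_left _ _)
  have h2 : bounceTime U ε x v e (k + 2) ≤ exitTime U xstar γ ε x v e := hk.trans (min_le_right _ _)
  have hfin : bounceTime U ε x v e (k + 2) ≠ ⊤ := ne_top_of_le_ne_top ENNReal.ofReal_ne_top h1
  obtain ⟨ha, hb⟩ := bounds_of_bounceTime_le hB hε he k hfin h2
  have ht : (bounceTime U ε x v e (k + 2)).toReal ≤ max t 0 := by
    rw [← ENNReal.toReal_ofReal']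
    exact ENNReal.toReal_mono ENNReal.ofReal_ne_top h1
  have hmem : (v, t, e) ∈ lateBounceSet (unitNormal U x) (M / g) (√(M / ε)) k := by
    constructor
    · refine inner_unitNormal_le hB hx (ha.trans ?_)
      gcongr
    · have hinv : √(M / ε) * √(ε / M) = 1 := by
        rw [← Real.sqrt_mul (by positivity), div_mul_div_cancel₀ hε.ne', div_self hM.ne',
          Real.sqrt_one]
      have h3 := mul_le_mul_of_nonneg_left
        (hb.trans (mul_le_mul_of_nonneg_left ht (norm_nonneg v))) (Real.sqrt_nonneg (M / ε))
      rw [← mul_assoc, hinv, one_mul] at h3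
      refine h3.trans_eq ?_
      ring
  rw [Set.indicator_of_mem hmem, Pi.one_apply]

lemma lintegral_lateBounceSet_le {C : ℝ} (hC : 0 ≤ C) {n : Space d}
    (hn : ∀ t : ℝ, 0 ≤ t → ∫⁻ v, {v : Space d | |inner ℝ n v| ≤ t * ‖v‖ ^ 2}.indicator
      (fun v => ENNReal.ofReal ‖v‖) v ∂(stdGaussian (Space d)) ≤ ENNReal.ofReal (C * t))
    {κ l : ℝ} (hκ : 0 ≤ κ) (hl : 0 ≤ l) (hρ : 0 < ρ) :
    ∫⁻ ω, ∑' k : ℕ, (lateBounceSet n κ l k).indicator 1 ω ∂(driveLaw d ρ) ≤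
      ENNReal.ofReal (18 + 36 * l * C * κ / ρ ^ 2) := by
  have := isProbabilityMeasure_expMeasure hρ
  have hmeas : Measurable fun ω : Space d × ℝ × (ℕ → ℝ) =>
      ∑' k : ℕ, (lateBounceSet n κ l k).indicator (1 : Space d × ℝ × (ℕ → ℝ) → ENNReal) ω :=
    Measurable.tsum fun k => measurable_one.indicator (measurableSet_lateBounceSet n κ l k)
  -- `F` is the renewal bound `18 (1 + l t ‖v‖)` with its second term restricted to the slab. Off
  -- the slab the sum vanishes, so keeping the constant `18` there does no harm.
  set F : Space d → ℝ → ENNReal := fun v t => ENNReal.ofReal 18 + ENNReal.ofReal (18 * l * max t 0) *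
    {v : Space d | |inner ℝ n v| ≤ κ * max t 0 * ‖v‖ ^ 2}.indicator
      (fun v => ENNReal.ofReal ‖v‖) v with hF
  have hFm : Measurable (Function.uncurry F) := by
    have hs : MeasurableSet {p : Space d × ℝ | |inner ℝ n p.1| ≤ κ * max p.2 0 * ‖p.1‖ ^ 2} :=
      measurableSet_le (by fun_prop) (by fun_prop)
    have hi := Measurable.indicator (f := fun p : Space d × ℝ => ENNReal.ofReal ‖p.1‖)
      (by fun_prop) hs
    have hc : Measurable fun p : Space d × ℝ => ENNReal.ofReal (18 * l * max p.2 0) := by fun_prop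
    exact measurable_const.add (hc.mul hi)
  have hinner : ∀ (v : Space d) (t : ℝ), ∫⁻ e, ∑' k : ℕ, (lateBounceSet n κ l k).indicator 1 (v, t, e)
      ∂thresholdLaw ≤ F v t := by
    intro v t
    by_cases hv : |inner ℝ n v| ≤ κ * max t 0 * ‖v‖ ^ 2
    · have heq : ∀ k e, (lateBounceSet n κ l k).indicator (1 : Space d × ℝ × (ℕ → ℝ) → ENNReal) (v, t, e) =
          {e : ℕ → ℝ | ∑ j ∈ Finset.range (k + 1), √(e (j + 1)) ≤ l * max t 0 * ‖v‖}.indicator 1 e := by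
        intro k e
        simp only [lateBounceSet, Set.indicator_apply, Set.mem_ofPred_eq, hv, true_and, Pi.one_apply]
      have hm : ∀ k : ℕ, MeasurableSet
          {e : ℕ → ℝ | ∑ j ∈ Finset.range (k + 1), √(e (j + 1)) ≤ l * max t 0 * ‖v‖} :=
        fun k => measurableSet_le (by fun_prop) (by fun_prop)
      simp only [heq]
      rw [lintegral_tsum fun k => (measurable_one.indicator (hm k)).aemeasurable]
      simp only [lintegral_indicator_one (hm _)]
      refine (tsum_thresholdLaw_sum_sqrt_le (by positivity)).trans (le_of_eq ?_)
      rw [hF]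
      simp only
      rw [Set.indicator_of_mem (by exact hv), ← ENNReal.ofReal_mul (by positivity),
        ← ENNReal.ofReal_add (by norm_num) (by positivity)]
      congr 1
      ring
    · have heq : ∀ k e, (lateBounceSet n κ l k).indicator (1 : Space d × ℝ × (ℕ → ℝ) → ENNReal) (v, t, e) = 0 := by
        intro k e
        exact Set.indicator_of_notMem (fun h => hv h.1) _
      simp [heq]
  have hunfold : driveLaw d ρ = (stdGaussian (Space d)).prod ((expMeasure ρ).prod thresholdLaw) := rfl
  rw [hunfold, lintegral_prod _ hmeas.aemeasurable]
  have hstep : ∀ v : Space d, ∫⁻ p, ∑' k : ℕ, (lateBounceSet n κ l k).indicator 1 (v, p)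
      ∂((expMeasure ρ).prod thresholdLaw) ≤ ∫⁻ t, F v t ∂(expMeasure ρ) := by
    intro v
    have hm : Measurable fun p : ℝ × (ℕ → ℝ) =>
        ∑' k : ℕ, (lateBounceSet n κ l k).indicator (1 : Space d × ℝ × (ℕ → ℝ) → ENNReal) (v, p) :=
      hmeas.comp measurable_prodMk_left
    rw [lintegral_prod _ hm.aemeasurable]
    exact lintegral_mono fun t => hinner v t
  refine (lintegral_mono hstep).trans ?_
  -- The slab width depends on `t`, so the velocity is integrated first with `t` fixed. One factor
  -- `t` comes from the renewal bound and one from the slab, and the second moment `2/ρ²` produces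
  -- `ρ⁻²`.
  rw [lintegral_lintegral_swap hFm.aemeasurable]
  have hstep2 : ∀ t : ℝ, ∫⁻ v, F v t ∂(stdGaussian (Space d)) ≤
      ENNReal.ofReal 18 + ENNReal.ofReal (18 * l * C * κ) * ENNReal.ofReal (max t 0 ^ 2) := by
    intro t
    have hs : MeasurableSet {v : Space d | |inner ℝ n v| ≤ κ * max t 0 * ‖v‖ ^ 2} :=
      measurableSet_le (by fun_prop) (by fun_prop)
    have hi := Measurable.indicator (f := fun v : Space d => ENNReal.ofReal ‖v‖) (by fun_prop) hs
    simp only [hF]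
    rw [lintegral_add_left measurable_const, lintegral_const, measure_univ, mul_one,
      lintegral_const_mul _ hi]
    refine add_le_add le_rfl ?_
    calc _ ≤ ENNReal.ofReal (18 * l * max t 0) * ENNReal.ofReal (C * (κ * max t 0)) :=
          mul_le_mul' le_rfl (hn _ (by positivity))
      _ = _ := by
          rw [← ENNReal.ofReal_mul (by positivity), ← ENNReal.ofReal_mul (by positivity)]
          congr 1
          ring
  refine (lintegral_mono hstep2).trans (le_of_eq ?_)
  rw [lintegral_add_left measurable_const, lintegral_const, measure_univ, mul_one,
    lintegral_const_mul _ (by fun_prop), lintegral_expMeasure_pow hρ,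
    ← ENNReal.ofReal_mul (by positivity), ← ENNReal.ofReal_add (by norm_num) (by positivity)]
  congr 1
  simp only [Nat.factorial_two, Nat.cast_ofNat]
  ring

/-- Upper bound for the expected number of bounces, without any restriction on the refreshment
rate. -/
lemma exists_expectedBounces_le (hd : 1 ≤ d) (hB : DerivBounds U (band U xstar γ) m M g G) :
    ∃ C > 0, ∀ ε > 0, ∀ ρ > 0, ∀ x ∈ band U xstar γ,
      expectedBounces U xstar γ ε ρ x ≤ ENNReal.ofReal (C * (1 + (√ε * ρ ^ 2)⁻¹)) := by
  obtain ⟨C, hC, hslab⟩ := exists_lintegral_norm_slab_le hd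
  have hM := hB.M_pos
  have hg := hB.g_pos
  refine ⟨19 + 36 * √M * C * (M / g), by positivity, fun ε hε ρ hρ x hx => ?_⟩
  have := isProbabilityMeasure_expMeasure hρ
  have : IsProbabilityMeasure (driveLaw d ρ) := by
    change IsProbabilityMeasure ((stdGaussian (Space d)).prod ((expMeasure ρ).prod thresholdLaw))
    infer_instance
  have hgrad : gradient U x ≠ 0 := norm_pos_iff.1 (hg.trans_le (hB.gradient_lower x hx))
  have h1 := lintegral_lateBounceSet_le hC (hslab _ (norm_unitNormal hgrad))
    (κ := M / g) (l := √(M / ε)) (by positivity) (by positivity) hρ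
  rw [expectedBounces]
  refine (lintegral_mono_ae ((ae_driveLaw_pos hρ).mono fun ω hω =>
    bounceCount_le hB hε hx (v := ω.1) (t := ω.2.1) hω)).trans ?_
  rw [lintegral_add_left measurable_const, lintegral_const, measure_univ, mul_one]
  refine (add_le_add le_rfl h1).trans ?_
  rw [← ENNReal.ofReal_one, ← ENNReal.ofReal_add zero_le_one (by positivity)]
  refine ENNReal.ofReal_le_ofReal ?_
  rw [Real.sqrt_div hM.le]
  have h2 : 36 * (√M / √ε) * C * (M / g) / ρ ^ 2 = 36 * √M * C * (M / g) * (√ε * ρ ^ 2)⁻¹ := by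
    rw [mul_inv]; ring
  rw [h2]
  have h3 : 0 ≤ (√ε * ρ ^ 2)⁻¹ := by positivity
  have h4 : 0 ≤ 36 * √M * C * (M / g) := by positivity
  nlinarith

lemma le_bounceCount {v : Space d} {e : ℕ → ℝ} {t D : ℝ} {k : ℕ} (ht : D ≤ t)
    (hk : bounceTime U ε x v e k ≤ ENNReal.ofReal D)
    (hexit : ENNReal.ofReal D ≤ exitTime U xstar γ ε x v e) :
    (k : ENNReal) ≤ (bounceCount U xstar γ ε x v e (ENNReal.ofReal t) : ENNReal) := by
  have h1 : ((Finset.range k : Finset ℕ) : Set ℕ) ⊆ {j : ℕ | bounceTime U ε x v e (j + 1) ≤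
      min (ENNReal.ofReal t) (exitTime U xstar γ ε x v e)} := by
    intro j hj
    have hj : j < k := by simpa using hj
    have h2 : bounceTime U ε x v e (j + 1) ≤ ENNReal.ofReal D := (bounceTime_monotone hj).trans hk
    exact le_min (h2.trans (ENNReal.ofReal_le_ofReal ht)) (h2.trans hexit)
  have h2 := Set.encard_le_encard h1
  rw [Set.encard_coe_eq_coe_finsetCard, Finset.card_range] at h2
  exact_mod_cast (ENat.toENNReal_le.2 h2)

/-- Lower bound for the expectation by the value on a product event. -/
lemma mul_measure_le_expectedBounces (hρ : 0 < ρ) {A : Set (Space d)} {E : Set (ℕ → ℝ)} {D : ℝ}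
    (hA : MeasurableSet A) (hE : MeasurableSet E) (hD : 0 ≤ D) {k : ℕ} {p : ℝ} (hp : 0 ≤ p)
    (hpA : ENNReal.ofReal p ≤ stdGaussian (Space d) A)
    (hpE : ENNReal.ofReal (1 / 2) ≤ thresholdLaw E)
    (h : ∀ v ∈ A, ∀ t ≥ D, ∀ e ∈ E, (∀ j, 0 < e j) →
      (k : ENNReal) ≤ (bounceCount U xstar γ ε x v e (ENNReal.ofReal t) : ENNReal)) :
    ENNReal.ofReal (k * (p * (Real.exp (-(ρ * D)) / 2))) ≤ expectedBounces U xstar γ ε ρ x := by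
  have := isProbabilityMeasure_expMeasure hρ
  have hS : MeasurableSet (A ×ˢ Set.Ici D ×ˢ E) := hA.prod (measurableSet_Ici.prod hE)
  have hle : ∀ᵐ ω ∂(driveLaw d ρ), (A ×ˢ Set.Ici D ×ˢ E).indicator (fun _ => (k : ENNReal)) ω ≤
      (bounceCount U xstar γ ε x ω.1 ω.2.2 (ENNReal.ofReal ω.2.1) : ENNReal) := by
    filter_upwards [ae_driveLaw_pos hρ] with ω hω
    exact Set.indicator_apply_le' (fun hm => h _ hm.1 _ hm.2.1 _ hm.2.2 hω) fun _ => zero_le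
  refine le_trans ?_ (lintegral_mono_ae hle)
  have hunfold : driveLaw d ρ = (stdGaussian (Space d)).prod ((expMeasure ρ).prod thresholdLaw) := rfl
  rw [lintegral_indicator hS, setLIntegral_const, hunfold, Measure.prod_prod, Measure.prod_prod,
    expMeasure_Ici hρ hD, ENNReal.ofReal_mul (by positivity), ENNReal.ofReal_mul hp,
    div_eq_mul_one_div, ENNReal.ofReal_mul (Real.exp_pos _).le, ENNReal.ofReal_natCast]
  gcongr

lemma measurableSet_slab (n : Space d) (a b R : ℝ) :
    MeasurableSet {v : Space d | inner ℝ n v ∈ Set.Icc a b ∧ 1 ≤ ‖v‖ ∧ ‖v‖ ≤ R} :=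
  ((by fun_prop : Measurable fun v : Space d => inner ℝ n v) measurableSet_Icc).inter
    ((measurableSet_le measurable_const measurable_norm).inter
      (measurableSet_le measurable_norm measurable_const))

/-- Lower bound for the expected number of bounces, for refreshment rates bounded below and
small compared to `ε^(-1/2)`. -/
lemma exists_le_expectedBounces (hd : 2 ≤ d) (hB : DerivBounds U (band U xstar γ) m M g G)
    {r ρ₀ : ℝ} (hr : 0 < r) (hρ₀ : 0 < ρ₀) :
    ∃ c > 0, ∃ κ > 0, ∀ ε > 0, ∀ ρ ≥ ρ₀, √ε * ρ ≤ κ → ∀ x,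
      Metric.closedBall x r ⊆ band U xstar γ →
      ENNReal.ofReal (c * (1 + (√ε * ρ ^ 2)⁻¹)) ≤ expectedBounces U xstar γ ε ρ x := by
  obtain ⟨c, hc, R, hR1, hslab⟩ := exists_le_stdGaussian_slab hd
  have hR : 0 < R := by linarith
  have hm := hB.m_pos
  have hM := hB.M_pos
  have hG := hB.G_pos
  -- The time window is `D = δ/ρ`. This `δ` keeps paths of speed at most `R` in the ball up to `D`,
  -- since `ρ ≥ ρ₀`, and no refreshment occurs before `D` with the fixed probability `exp (-δ)`.
  set δ := r * ρ₀ / R with hδ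
  have hδ0 : 0 < δ := by positivity
  -- The slab has width `b/ρ`. The first bound makes it at most `1`, and the second makes overcoming
  -- the initial slope cost at most `D/2`.
  set b := min ρ₀ (δ * m / (2 * G)) with hb
  have hb0 : 0 < b := by positivity
  set A := 2 * √m⁻¹ + 2 * √(M * R ^ 2) / m with hA
  have hA0 : 0 < A := by positivity
  set q := Real.exp (-δ) / 2 with hq
  have hq0 : 0 < q := by positivity
  set c1 := c * q with hc1
  set c2 := δ / (8 * A) * (c * b * q) with hc2
  -- The first bound on `√ε ρ` fits the first bounce of an uphill start into the window. The second
  -- makes `y ≥ 2` below, so that taking the integer part loses at most a factor two.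
  refine ⟨min c1 c2 / 2, by positivity, min (δ * √m / 4) (δ / (8 * A)), by positivity,
    fun ε hε ρ hρ hερ x hx => ?_⟩
  have hρ0 : 0 < ρ := hρ₀.trans_le hρ
  have hsε : 0 < √ε := Real.sqrt_pos.2 hε
  have hxB : x ∈ band U xstar γ := hx (Metric.mem_closedBall_self hr.le)
  have hgrad : gradient U x ≠ 0 := norm_pos_iff.1 (hB.g_pos.trans_le (hB.gradient_lower x hxB))
  have hn := norm_unitNormal hgrad
  set D := δ / ρ with hD
  have hD0 : 0 < D := by positivity
  have hDR : D * R ≤ r := by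
    rw [hD, hδ, div_div, div_mul_eq_mul_div, div_le_iff₀ (by positivity)]
    have := mul_le_mul_of_nonneg_left hρ (mul_pos hr hR).le
    linarith
  have hexit : ∀ (v : Space d) (e : ℕ → ℝ), ‖v‖ ≤ R →
      ENNReal.ofReal D ≤ exitTime U xstar γ ε x v e := fun v e hv =>
    le_exitTime_of_closedBall_subset hx ((mul_le_mul_of_nonneg_left hv hD0.le).trans hDR)
  have hρD : Real.exp (-(ρ * D)) / 2 = q := by
    rw [hq, hD, mul_div_cancel₀ _ hρ0.ne']
  have hmE : ∀ k : ℕ, MeasurableSet {e : ℕ → ℝ | ∑ j ∈ Finset.range k, √(e j) ≤ 2 * k} :=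
    fun k => measurableSet_le (by fun_prop) measurable_const
  have hfirst : ENNReal.ofReal c1 ≤ expectedBounces U xstar γ ε ρ x := by
    -- The sign change selects uphill velocities, with normal component in `[0, 1]`.
    have h1 := hslab (-unitNormal U x) (by rwa [norm_neg]) 1 zero_le_one le_rfl
    rw [mul_one] at h1
    have h2 := mul_measure_le_expectedBounces (U := U) (xstar := xstar) (γ := γ) (ε := ε) (x := x)
      (k := 1) hρ0 (measurableSet_slab _ _ _ _) (hmE 1) hD0.le hc.le h1
      (half_le_thresholdLaw_sum_sqrt 1) ?_
    · rw [hρD] at h2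
      simpa [hc1] using h2
    rintro v ⟨hv, hv1, hvR⟩ t ht e he hepos
    refine le_bounceCount ht ?_ (hexit v e hvR)
    refine bounceTime_one_le hB hε (hepos 0) hx hv1 hvR hDR ?_ ?_
    · rw [slope_eq_norm_mul]
      have := hv.2
      rw [inner_neg_left] at this
      exact mul_nonneg (norm_nonneg _) (by linarith)
    · have h3 : √(e 0) ≤ 2 := by simpa using he
      rw [Real.sqrt_div (by have := hepos 0; positivity), Real.sqrt_mul hε.le, hD,
        le_div_iff₀ hρ0, mul_div_assoc', div_mul_eq_mul_div, div_le_iff₀ (Real.sqrt_pos.2 hm)]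
      have h4 := hερ.trans (min_le_left _ _)
      have h5 : √ε * ρ * √(e 0) ≤ √ε * ρ * 2 := mul_le_mul_of_nonneg_left h3 (by positivity)
      linarith
  have hsecond : ENNReal.ofReal (c2 * (√ε * ρ ^ 2)⁻¹) ≤ expectedBounces U xstar γ ε ρ x := by
    -- Chosen so that `√ε A · 2y = D/2`: on the event that the sum of the `√e` is at most `2k`, the
    -- first `k` bounces use the half of the window left over by the initial slope.
    set y := δ / (4 * A * (√ε * ρ)) with hy
    have hy2 : 2 ≤ y := by
      rw [hy, le_div_iff₀ (by positivity)]
      have h4 := hερ.trans (min_le_right _ _)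
      rw [le_div_iff₀ (by positivity)] at h4
      linarith
    set k := ⌊y⌋₊ with hk
    have hky : (k : ℝ) ≤ y := Nat.floor_le (by linarith)
    have hky' : y / 2 ≤ k := by
      have := Nat.lt_floor_add_one y
      linarith
    have hη1 : b / ρ ≤ 1 := (div_le_one hρ0).2 ((min_le_left _ _).trans hρ)
    have h1 := hslab (unitNormal U x) hn (b / ρ) (by positivity) hη1
    have h2 := mul_measure_le_expectedBounces (U := U) (xstar := xstar) (γ := γ) (ε := ε) (x := x)
      (k := k) hρ0 (measurableSet_slab _ _ _ _) (hmE k) hD0.le (by positivity) h1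
      (half_le_thresholdLaw_sum_sqrt k) ?_
    · refine le_trans (ENNReal.ofReal_le_ofReal ?_) h2
      rw [hρD]
      calc c2 * (√ε * ρ ^ 2)⁻¹ = y / 2 * (c * (b / ρ) * q) := by
            rw [hc2, hy]; field_simp; norm_num
        _ ≤ k * (c * (b / ρ) * q) := by gcongr
    rintro v ⟨hv, hv1, hvR⟩ t ht e he hepos
    have hslope := slope_eq_norm_mul (U := U) x v
    refine le_bounceCount ht ?_ (hexit v e hvR)
    refine bounceTime_le_of_slope_nonpos hB hε hepos hx hv1 hvR hDR ?_ k ?_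
    · rw [hslope]
      exact mul_nonpos_of_nonneg_of_nonpos (norm_nonneg _) hv.2
    · have h3 : -slope U x v ≤ G * (b / ρ) := by
        rw [hslope, ← mul_neg]
        exact mul_le_mul (hB.gradient_upper x hxB) (by linarith [hv.1]) (by linarith [hv.2]) hG.le
      have h4 : -slope U x v / m ≤ D / 2 := by
        rw [div_le_iff₀ hm]
        refine h3.trans ?_
        have h5 : b ≤ δ * m / (2 * G) := min_le_right _ _
        rw [le_div_iff₀ (by positivity)] at h5
        rw [hD, mul_div_assoc', div_div, div_mul_eq_mul_div, div_le_div_iff₀ hρ0 (by positivity)]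
        nlinarith
      have h6 : √ε * A * ∑ j ∈ Finset.range k, √(e j) ≤ D / 2 := by
        calc _ ≤ √ε * A * (2 * y) := by
              refine mul_le_mul_of_nonneg_left ?_ (by positivity)
              have he : ∑ j ∈ Finset.range k, √(e j) ≤ 2 * k := he
              linarith
          _ = D / 2 := by rw [hy, hD]; field_simp; norm_num
      linarith
  have h3 : 0 < (√ε * ρ ^ 2)⁻¹ := by positivity
  -- The larger of the two lower bounds is at least half their sum.
  rcases le_total c1 (c2 * (√ε * ρ ^ 2)⁻¹) with h | h
  · refine le_trans (ENNReal.ofReal_le_ofReal ?_) hsecond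
    have h4 : min c1 c2 * (√ε * ρ ^ 2)⁻¹ ≤ c2 * (√ε * ρ ^ 2)⁻¹ := by gcongr; exact min_le_right _ _
    have h5 := min_le_left c1 c2
    linarith
  · refine le_trans (ENNReal.ofReal_le_ofReal ?_) hfirst
    have h4 : min c1 c2 * (√ε * ρ ^ 2)⁻¹ ≤ c2 * (√ε * ρ ^ 2)⁻¹ := by gcongr; exact min_le_right _ _
    have h5 := min_le_left c1 c2
    linarith

end

end BouncyParticle

/-! ### Both regimes of the refreshment rate. -/

theorem mainTheorem3 (d : ℕ) (hd : 2 ≤ d)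
    (U : BouncyParticle.Space d → ℝ) (xstar : BouncyParticle.Space d)
    (hU : BouncyParticle.IsAdmissiblePotential U xstar)
    (γ : ℝ) (hγ : 0 < γ) (hγ' : γ < 1 / 2)
    (ρ : ℝ → ℝ) (hρ : ∀ ε, 0 < ε → 0 < ρ ε)
    (hρ' : (∃ r : ℝ, ∀ ε, 0 < ε → ρ ε = r) ∨
      (Tendsto ρ (𝓝[>] 0) atTop ∧ Tendsto (fun ε : ℝ => √ε * ρ ε) (𝓝[>] 0) (𝓝 0))) :
    (∃ c C : ℝ, 0 < c ∧ 0 < C ∧ ∀ᶠ ε : ℝ in 𝓝[>] 0, ∀ x : BouncyParticle.Space d,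
      U xstar + 2 * γ < U x → U x < U xstar + (2 * γ)⁻¹ →
        ENNReal.ofReal (c * (1 + (√ε * ρ ε ^ 2)⁻¹))
            ≤ BouncyParticle.expectedBounces U xstar γ ε (ρ ε) x ∧
        BouncyParticle.expectedBounces U xstar γ ε (ρ ε) x
            ≤ ENNReal.ofReal (C * (1 + (√ε * ρ ε ^ 2)⁻¹))) ∧
    ((∃ r : ℝ, ∀ ε, 0 < ε → ρ ε = r) →
      ∃ c C : ℝ, 0 < c ∧ 0 < C ∧ ∀ᶠ ε : ℝ in 𝓝[>] 0, ∀ x : BouncyParticle.Space d,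
        U xstar + 2 * γ < U x → U x < U xstar + (2 * γ)⁻¹ →
          ENNReal.ofReal (c * (√ε)⁻¹)
              ≤ BouncyParticle.expectedBounces U xstar γ ε (ρ ε) x ∧
          BouncyParticle.expectedBounces U xstar γ ε (ρ ε) x
              ≤ ENNReal.ofReal (C * (√ε)⁻¹)) := by
  obtain ⟨m, M, g, G, hB⟩ := BouncyParticle.exists_derivBounds hU hγ
  obtain ⟨r, hr, hball⟩ := BouncyParticle.exists_closedBall_subset_band hU hγ
  obtain ⟨C, hC, hupper⟩ := BouncyParticle.exists_expectedBounces_le (by omega) hB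
  have hpos : ∀ᶠ ε : ℝ in 𝓝[>] 0, 0 < ε := self_mem_nhdsWithin
  have hsqrt : Tendsto (fun ε : ℝ => √ε) (𝓝[>] 0) (𝓝 0) := by
    simpa using (Real.continuous_sqrt.tendsto 0).mono_left nhdsWithin_le_nhds
  -- Both regimes enter only through two facts: `ρ` is eventually bounded below by a positive
  -- constant, and `√ε ρ → 0`.
  obtain ⟨ρ₀, hρ₀, hρge⟩ : ∃ ρ₀ > 0, ∀ᶠ ε : ℝ in 𝓝[>] 0, ρ₀ ≤ ρ ε := by
    rcases hρ' with ⟨s, hs⟩ | ⟨hinf, -⟩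
    · refine ⟨s, (hρ 1 one_pos).trans_eq (hs 1 one_pos), ?_⟩
      filter_upwards [hpos] with ε hε using (hs ε hε).ge
    · exact ⟨1, one_pos, hinf.eventually_ge_atTop 1⟩
  have hsmall : Tendsto (fun ε : ℝ => √ε * ρ ε) (𝓝[>] 0) (𝓝 0) := by
    rcases hρ' with ⟨s, hs⟩ | ⟨-, h⟩
    · have h1 : Tendsto (fun ε : ℝ => √ε * s) (𝓝[>] 0) (𝓝 0) := by
        simpa using hsqrt.mul_const s
      refine h1.congr' ?_
      filter_upwards [hpos] with ε hε
      rw [hs ε hε]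
    · exact h
  obtain ⟨c, hc, κ, hκ, hlower⟩ := BouncyParticle.exists_le_expectedBounces hd hB hr hρ₀
  have hmain : ∀ᶠ ε : ℝ in 𝓝[>] 0, ∀ x : BouncyParticle.Space d,
      U xstar + 2 * γ < U x → U x < U xstar + (2 * γ)⁻¹ →
        ENNReal.ofReal (c * (1 + (√ε * ρ ε ^ 2)⁻¹))
            ≤ BouncyParticle.expectedBounces U xstar γ ε (ρ ε) x ∧
        BouncyParticle.expectedBounces U xstar γ ε (ρ ε) x
            ≤ ENNReal.ofReal (C * (1 + (√ε * ρ ε ^ 2)⁻¹)) := by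
    filter_upwards [hpos, hρge, hsmall.eventually_le_const hκ] with ε hε h1 h2 x hx1 hx2
    have hsub := hball x hx1 hx2
    exact ⟨hlower ε hε _ h1 h2 x hsub,
      hupper ε hε _ (hρ ε hε) x (hsub (Metric.mem_closedBall_self hr.le))⟩
  refine ⟨⟨c, C, hc, hC, hmain⟩, ?_⟩
  rintro ⟨s, hs⟩
  have hs0 : 0 < s := (hρ 1 one_pos).trans_eq (hs 1 one_pos)
  -- For constant `ρ = s` the summand `1` is dropped from the lower bound. In the upper bound it is
  -- absorbed by `1 ≤ (√ε)⁻¹`.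
  refine ⟨c * (s ^ 2)⁻¹, C * (1 + (s ^ 2)⁻¹), by positivity, by positivity, ?_⟩
  filter_upwards [hmain, hpos, hsqrt.eventually_le_const one_pos] with ε h hε hε1 x hx1 hx2
  obtain ⟨h1, h2⟩ := h x hx1 hx2
  have hsε : 0 < √ε := Real.sqrt_pos.2 hε
  have hone : 1 ≤ (√ε)⁻¹ := (one_le_inv₀ hsε).2 hε1
  have hs2 : 0 < (s ^ 2)⁻¹ := by positivity
  have hρs : (√ε * ρ ε ^ 2)⁻¹ = (√ε)⁻¹ * (s ^ 2)⁻¹ := by rw [hs ε hε, mul_inv]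
  rw [hρs] at h1 h2
  refine ⟨(ENNReal.ofReal_le_ofReal ?_).trans h1, h2.trans (ENNReal.ofReal_le_ofReal ?_)⟩
  · rw [mul_assoc, mul_comm (s ^ 2)⁻¹]
    gcongr
    linarith
  · rw [mul_assoc]
    gcongr
    linarith
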